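/- Let $(\bar M,\bar\varphi,\bar\xi_\alpha,\bar\eta^\alpha,\bar g)$, $\alpha\in\{1,\dots,r\}$, $r\ge 1$, be an indefinite $\mathcal S$-manifold. That is: $\bar g$ is a semi-Riemannian metric of index $\nu$ with $0<\nu<\dim\bar M$; $\bar\varphi\neq 0$ is a $(1,1)$-tensor field; $\bar\xi_1,\dots,\bar\xi_r$ are global vector fields that span $\ker\bar\varphi$ at each point, and $\bar\eta^1,\dots,\bar\eta^r$ are $1$-forms with $\bar\eta^\alpha(\bar\xi_\beta)=\delta^\alpha_\beta$ and $\bar\varphi^2=-I+\sum_\alpha\bar\eta^\alpha\otimes\bar\xi_\alpha$; $\bar g(\bar\varphi X,\bar\varphi Y)=\bar g(X,Y)-\sum_\alpha\varepsilon_\alpha\bar\eta^\alpha(X)\bar\eta^\alpha(Y)$, where $\varepsilon_\alpha=\bar g(\bar\xi_\alpha,\bar\xi_\alpha)=\pm1$; and, with $[\bar\varphi,\bar\varphi]$ the Nijenhuis torsion of $\bar\varphi$, one has $[\bar\varphi,\bar\varphi]+2\sum_\alpha d\bar\eta^\alpha\otimes\bar\xi_\alpha=0$ and $d\bar\eta^\alpha(X,Y)=\bar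 g(X,\bar\varphi Y)$ for every $\alpha$, with the convention $2\,d\eta(X,Y)=X\eta(Y)-Y\eta(X)-\eta([X,Y])$. All manifolds, tensor fields and maps are smooth. Let $M$ be a characteristic lightlike hypersurface of $\bar M$: an immersed hypersurface whose induced metric $g$ is degenerate at every point (so that $\mathrm{Rad}(TM)=TM\cap TM^\perp$ is a line bundle), and to which all $\bar\xi_\alpha$ are tangent. Let $S(TM)$ be a characteristic screen distribution on $M$: a distribution with $TM=\mathrm{Rad}(TM)\oplus S(TM)$, $\ker\bar\varphi\subset S(TM)$ and $\bar\varphi(\mathrm{Rad}(TM))\subset S(TM)$. Let $\mathrm{ltr}(M)$ be the lightlike transversal line bundle: for a nowhere vanishing section $E$ of $\mathrm{Rad}(TM)$ on an open set $\mathcal U\subset M$, it is spanned on $\mathcal U$ by the unique section $N$ with $\bar g(N,E)=1$, $\bar g(N,N)=0$ and $\bar g(N,W)=0$ for $W\in S(TM)$. Then $T\bar M|_M=TM\oplus \mathrm{ltr}(M)$. Let $\bar\nabla$ be the Levi-Civita connection of $\bar g$. Write $\bar\nabla_XY=\nabla_XY+h(X,Y)$ according to $T\bar M|_M=TM\oplus\mathrm{ltr}(M)$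 and, for $Y\in\Gamma(S(TM))$, $\nabla_XY=\overset{*}{\nabla}_XY+\overset{*}{h}(X,Y)$ according to $TM=S(TM)\oplus\mathrm{Rad}(TM)$. Put $B(X,Y)=\bar g(h(X,Y),E)$ and $C(X,Y)=\bar g(\overset{*}{h}(X,Y),N)$ on $\mathcal U$. Let $D_0$ be the orthogonal complement of $\bar\varphi(\mathrm{Rad}(TM))\oplus\bar\varphi(\mathrm{ltr}(M))$ in $S(TM)$; it is a $\bar\varphi$-invariant distribution on $M$. Fix nowhere vanishing sections $E$ of $\mathrm{Rad}(TM)$ on the sets $\mathcal U$ of an open cover of $M$ (for instance one global $E$, if it exists), with the corresponding $N$, $B$, $C$. Then the distribution $D_0$ is integrable (that is, $[X,Y]\in\Gamma(D_0)$ for all $X,Y\in\Gamma(D_0)$) if and only if, for all $X,Y\in\Gamma(D_0)$, on each $\mathcal U$ of the cover, $$C(X,Y)=C(Y,X),\qquad C(X,\bar\varphi Y)=C(\bar\varphi X,Y),\qquad B(X,\bar\varphi Y)=B(\bar\varphi X,Y).$$ -/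

import Mathlib

open Bundle Manifold ContDiff Topology

noncomputable section

namespace Lightlike

/-! ## Smooth vector fields, distributions, projections -/

section General

variable {F : Type*} [NormedAddCommGroup F] [NormedSpace ℝ F]
  {M : Type*} [TopologicalSpace M] [ChartedSpace F M]

/-- The vector field `X` is smooth on the set `U`. -/
def SmoothOn [IsManifold 𝓘(ℝ, F) ∞ M] (X : ∀ x : M, TangentSpace 𝓘(ℝ, F) x) (U : Set M) : Prop :=
  ContMDiffOn 𝓘(ℝ, F) 𝓘(ℝ, F).tangent ∞ (fun x => (⟨x, X x⟩ : TangentBundle 𝓘(ℝ, F) M)) U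

/-- A field of subspaces is a (smooth) distribution if it is locally spanned by a smooth frame. -/
def IsDistribution [IsManifold 𝓘(ℝ, F) ∞ M]
    (D : ∀ x : M, Submodule ℝ (TangentSpace 𝓘(ℝ, F) x)) : Prop :=
  ∀ x₀ : M, ∃ (k : ℕ) (U : Set M) (e : Fin k → ∀ x : M, TangentSpace 𝓘(ℝ, F) x),
    IsOpen U ∧ x₀ ∈ U ∧ (∀ j, SmoothOn (e j) U) ∧
      ∀ x ∈ U, LinearIndependent ℝ (fun j => e j x) ∧
        Submodule.span ℝ (Set.range fun j => e j x) = D x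

/-- `X ∈ Γ(D)`: a smooth vector field on `M` with values in `D`. -/
def IsSection [IsManifold 𝓘(ℝ, F) ∞ M] (D : ∀ x : M, Submodule ℝ (TangentSpace 𝓘(ℝ, F) x))
    (X : ∀ x : M, TangentSpace 𝓘(ℝ, F) x) : Prop :=
  SmoothOn X Set.univ ∧ ∀ x, X x ∈ D x

/-- `D` is integrable (involutive): `[X, Y]` is tangent to `D` for all `X, Y ∈ Γ(D)`. -/
def IsIntegrable [IsManifold 𝓘(ℝ, F) ∞ M]
    (D : ∀ x : M, Submodule ℝ (TangentSpace 𝓘(ℝ, F) x)) : Prop :=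
  ∀ X Y : ∀ x : M, TangentSpace 𝓘(ℝ, F) x, IsSection D X → IsSection D Y →
    ∀ x, VectorField.mlieBracket 𝓘(ℝ, F) X Y x ∈ D x

end General

open Classical in
/-- The projection of `V = p ⊕ q` onto `p` along `q`. -/
def projAlong {V : Type*} [AddCommGroup V] [Module ℝ V] (p q : Submodule ℝ V) : V →ₗ[ℝ] V :=
  if h : IsCompl p q then Submodule.projection p q h else 0

/-! ## Semi-Riemannian metrics and the Levi-Civita connection along a map -/

section Metric

/-- A semi-Riemannian metric of constant index on the manifold `N`. -/
structure SemiRiemannianMetric (E : Type*) [NormedAddCommGroup E] [NormedSpace ℝ E]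
    (N : Type*) [TopologicalSpace N] [ChartedSpace E N] [IsManifold 𝓘(ℝ, E) ∞ N] where
  /-- the bilinear form at each point -/
  val : ∀ p : N, TangentSpace 𝓘(ℝ, E) p →L[ℝ] TangentSpace 𝓘(ℝ, E) p →L[ℝ] ℝ
  smooth : ContMDiff 𝓘(ℝ, E) (𝓘(ℝ, E).prod 𝓘(ℝ, E →L[ℝ] E →L[ℝ] ℝ)) ∞
    (fun p : N => TotalSpace.mk' (E →L[ℝ] E →L[ℝ] ℝ)
      (E := fun p : N => TangentSpace 𝓘(ℝ, E) p →L[ℝ] TangentSpace 𝓘(ℝ, E) p →L[ℝ] ℝ) p (val p))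
  symm : ∀ p u v, val p u v = val p v u
  nondegenerate : ∀ p u, (∀ v, val p u v = 0) → u = 0
  /-- the index -/
  index : ℕ
  /-- the index is the largest dimension of a negative definite subspace, at every point -/
  isGreatest_index : ∀ p : N, IsGreatest
    {k : ℕ | ∃ W : Submodule ℝ (TangentSpace 𝓘(ℝ, E) p),
      Module.finrank ℝ W = k ∧ ∀ w ∈ W, w ≠ 0 → val p w w < 0} index

variable {E : Type*} [NormedAddCommGroup E] [NormedSpace ℝ E]
  {N : Type*} [TopologicalSpace N] [ChartedSpace E N] [IsManifold 𝓘(ℝ, E) ∞ N]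

/-- The vector field near `p` whose components in the coordinates of the preferred chart at `p`
are constant and whose value at `p` is `u`. -/
def coordField (p : N) (u : TangentSpace 𝓘(ℝ, E) p) (q : N) : TangentSpace 𝓘(ℝ, E) q :=
  let t := trivializationAt E (TangentSpace 𝓘(ℝ, E) : N → Type _) p
  t.symmL ℝ q (t.continuousLinearMapAt ℝ p u)

/-- The right-hand side of the Koszul formula at `p` for the (commuting) coordinate fields that
extend `u`, `v`, `z`. -/
def koszul (g : SemiRiemannianMetric E N) (p : N) (u v z : TangentSpace 𝓘(ℝ, E) p) : ℝ :=
  mvfderiv 𝓘(ℝ, E) (fun q => g.val q (coordField p v q) (coordField p z q)) p u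
    + mvfderiv 𝓘(ℝ, E) (fun q => g.val q (coordField p u q) (coordField p z q)) p v
    - mvfderiv 𝓘(ℝ, E) (fun q => g.val q (coordField p u q) (coordField p v q)) p z

theorem mdifferentiableAt_coordField (p : N) (u : TangentSpace 𝓘(ℝ, E) p) :
    MDifferentiableAt 𝓘(ℝ, E) 𝓘(ℝ, E).tangent
      (fun q => (⟨q, coordField p u q⟩ : TangentBundle 𝓘(ℝ, E) N)) p := by
  let t := trivializationAt E (TangentSpace 𝓘(ℝ, E) : N → Type _) p
  have hp : p ∈ t.baseSet := FiberBundle.mem_baseSet_trivializationAt' p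
  refine (FiberBundle.mdifferentiableAt_extend 𝓘(ℝ, E) E u).congr_of_eventuallyEq ?_
  filter_upwards [t.open_baseSet.mem_nhds hp] with q hq
  have h : coordField p u q = t.symmL ℝ q (t.linearMapAt ℝ p u) := rfl
  rw [h, t.symmL_apply hq, t.coe_linearMapAt_of_mem hp]
  rfl

theorem mdifferentiableAt_metric_coordField (g : SemiRiemannianMetric E N) (p : N)
    (u v : TangentSpace 𝓘(ℝ, E) p) :
    MDifferentiableAt 𝓘(ℝ, E) 𝓘(ℝ, ℝ)
      (fun q => g.val q (coordField p u q) (coordField p v q)) p := by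
  have hg := (g.smooth p).mdifferentiableAt (by simp)
  have hu := mdifferentiableAt_coordField p u
  have hv := mdifferentiableAt_coordField p v
  have h : MDifferentiableAt 𝓘(ℝ, E) (𝓘(ℝ, E).prod 𝓘(ℝ, ℝ))
      (fun q => TotalSpace.mk' ℝ (E := Bundle.Trivial N ℝ) q
        (g.val q (coordField p u q) (coordField p v q))) p :=
    MDifferentiableAt.clm_bundle_apply₂ (F₁ := E) (F₂ := E) hg hu hv
  simpa using (mdifferentiableAt_section _ _).1 h

/-- A vector is determined by the Koszul formula. -/
theorem exists_christoffel [FiniteDimensional ℝ E] (g : SemiRiemannianMetric E N) (p : N)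
    (u v : TangentSpace 𝓘(ℝ, E) p) :
    ∃ w : TangentSpace 𝓘(ℝ, E) p, ∀ z, 2 * g.val p w z = koszul g p u v z := by
  have : FiniteDimensional ℝ (TangentSpace 𝓘(ℝ, E) p) := inferInstanceAs (FiniteDimensional ℝ E)
  have hd := mdifferentiableAt_metric_coordField g p
  let K : TangentSpace 𝓘(ℝ, E) p →ₗ[ℝ] ℝ :=
    { toFun := koszul g p u v
      map_add' := fun a b => by
        simp only [koszul, coordField, map_add] at hd ⊢
        rw [mvfderiv_fun_add (hd v a) (hd v b), mvfderiv_fun_add (hd u a) (hd u b)]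
        simp only [add_apply]
        ring
      map_smul' := fun c a => by
        simp only [koszul, coordField, map_smul, smul_eq_mul, RingHom.id_apply] at hd ⊢
        rw [mvfderiv_fun_mul mdifferentiableAt_const (hd v a),
          mvfderiv_fun_mul mdifferentiableAt_const (hd u a)]
        simp [mvfderiv_const]
        ring }
  let A : TangentSpace 𝓘(ℝ, E) p →ₗ[ℝ] Module.Dual ℝ (TangentSpace 𝓘(ℝ, E) p) :=
    LinearMap.mk₂ ℝ (fun w z => g.val p w z) (by simp) (by simp) (by simp) (by simp)
  have hA : Function.Injective A := by
    rw [← LinearMap.ker_eq_bot, LinearMap.ker_eq_bot']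
    exact fun w hw => g.nondegenerate p w fun z => LinearMap.congr_fun hw z
  have hs := (LinearMap.injective_iff_surjective_of_finrank_eq_finrank
    (Subspace.dual_finrank_eq (K := ℝ) (V := TangentSpace 𝓘(ℝ, E) p)).symm).1 hA
  obtain ⟨w, hw⟩ := hs ((1 / 2 : ℝ) • K)
  refine ⟨w, fun z => ?_⟩
  have h := LinearMap.congr_fun hw z
  change g.val p w z = 1 / 2 * koszul g p u v z at h
  rw [h]
  ring

/-- The Christoffel symbol `Γ(u, v)` of the Levi-Civita connection at `p`, in the coordinates of
the preferred chart at `p`: the unique vector `w` with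
`2 g(w, z) = u(g(v, z)) + v(g(u, z)) - z(g(u, v))` for coordinate fields `u`, `v`, `z`. -/
def christoffel [FiniteDimensional ℝ E] (g : SemiRiemannianMetric E N) (p : N)
    (u v : TangentSpace 𝓘(ℝ, E) p) : TangentSpace 𝓘(ℝ, E) p :=
  (exists_christoffel g p u v).choose

variable {F : Type*} [NormedAddCommGroup F] [NormedSpace ℝ F]
  {M : Type*} [TopologicalSpace M] [ChartedSpace F M]

/-- The Levi-Civita connection of `g`, pulled back along a map `i : M → N`, acting on a vector
field `W` along `i`: in the coordinates of the chart at `i x`, where `W = ∑ Wᵏ ∂ₖ`,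
`(∇̄_v W)(x) = ∑ dWᵏ(v) ∂ₖ + Γ(di v, W x)`. For `i = id` this is the Levi-Civita connection. -/
def leviCivitaAlong [FiniteDimensional ℝ E] (g : SemiRiemannianMetric E N) (i : M → N)
    (W : ∀ x : M, TangentSpace 𝓘(ℝ, E) (i x)) (x : M) (v : TangentSpace 𝓘(ℝ, F) x) :
    TangentSpace 𝓘(ℝ, E) (i x) :=
  let t := trivializationAt E (TangentSpace 𝓘(ℝ, E) : N → Type _) (i x)
  t.symmL ℝ (i x) (mvfderiv 𝓘(ℝ, F) (fun y => t.continuousLinearMapAt ℝ (i y) (W y)) x v)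
    + christoffel g (i x) (mfderiv 𝓘(ℝ, F) 𝓘(ℝ, E) i x v) (W x)

end Metric
/-! ## Indefinite `𝒮`-manifolds -/

section SManifold

variable {E : Type*} [NormedAddCommGroup E] [NormedSpace ℝ E]
  {N : Type*} [TopologicalSpace N] [ChartedSpace E N] [IsManifold 𝓘(ℝ, E) ∞ N]

/-- The exterior derivative of a `1`-form, with the convention
`2 dη(X, Y) = X(η(Y)) - Y(η(X)) - η([X, Y])`, on vector fields `X`, `Y` at `p`. -/
def extDeriv (η : ∀ p : N, TangentSpace 𝓘(ℝ, E) p →L[ℝ] ℝ)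
    (X Y : ∀ p : N, TangentSpace 𝓘(ℝ, E) p) (p : N) : ℝ :=
  (1 / 2) * (mvfderiv 𝓘(ℝ, E) (fun q => η q (Y q)) p (X p)
    - mvfderiv 𝓘(ℝ, E) (fun q => η q (X q)) p (Y p)
    - η p (VectorField.mlieBracket 𝓘(ℝ, E) X Y p))

/-- The Nijenhuis torsion
`N_φ(X, Y) = [φX, φY] + φ²[X, Y] - φ[φX, Y] - φ[X, φY]` on vector fields `X`, `Y` at `p`. -/
def nijenhuis (φ : ∀ p : N, TangentSpace 𝓘(ℝ, E) p →L[ℝ] TangentSpace 𝓘(ℝ, E) p)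
    (X Y : ∀ p : N, TangentSpace 𝓘(ℝ, E) p) (p : N) : TangentSpace 𝓘(ℝ, E) p :=
  VectorField.mlieBracket 𝓘(ℝ, E) (fun q => φ q (X q)) (fun q => φ q (Y q)) p
    + φ p (φ p (VectorField.mlieBracket 𝓘(ℝ, E) X Y p))
    - φ p (VectorField.mlieBracket 𝓘(ℝ, E) (fun q => φ q (X q)) Y p)
    - φ p (VectorField.mlieBracket 𝓘(ℝ, E) X (fun q => φ q (Y q)) p)

/-- An indefinite metric globally framed `f`-structure `(φ, ξ_α, η^α, g)`, `α ∈ {1, …, r}`.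
The rank of `φ` is constant, as `ξ_1, …, ξ_r` is a basis of `ker φ` at every point. -/
structure IndefiniteMetricGFF (r : ℕ) (E : Type*) [NormedAddCommGroup E] [NormedSpace ℝ E]
    (N : Type*) [TopologicalSpace N] [ChartedSpace E N] [IsManifold 𝓘(ℝ, E) ∞ N] where
  /-- the `(1,1)`-tensor field `φ` -/
  φ : ∀ p : N, TangentSpace 𝓘(ℝ, E) p →L[ℝ] TangentSpace 𝓘(ℝ, E) p
  /-- the characteristic vector fields -/
  ξ : Fin r → ∀ p : N, TangentSpace 𝓘(ℝ, E) p
  /-- the dual `1`-forms -/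
  η : Fin r → ∀ p : N, TangentSpace 𝓘(ℝ, E) p →L[ℝ] ℝ
  /-- the metric -/
  g : SemiRiemannianMetric E N
  /-- the causal characters of the `ξ_α` -/
  ε : Fin r → ℝ
  smooth_φ : ContMDiff 𝓘(ℝ, E) (𝓘(ℝ, E).prod 𝓘(ℝ, E →L[ℝ] E)) ∞
    (fun p : N => TotalSpace.mk' (E →L[ℝ] E)
      (E := fun p : N => TangentSpace 𝓘(ℝ, E) p →L[ℝ] TangentSpace 𝓘(ℝ, E) p) p (φ p))
  smooth_ξ : ∀ α, SmoothOn (ξ α) Set.univ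
  smooth_η : ∀ α, ContMDiff 𝓘(ℝ, E) (𝓘(ℝ, E).prod 𝓘(ℝ, E →L[ℝ] ℝ)) ∞
    (fun p : N => TotalSpace.mk' (E →L[ℝ] ℝ)
      (E := fun p : N => TangentSpace 𝓘(ℝ, E) p →L[ℝ] ℝ) p (η α p))
  φ_ne_zero : ∀ p, φ p ≠ 0
  ker_φ : ∀ p, LinearMap.ker (φ p).toLinearMap = Submodule.span ℝ (Set.range fun α => ξ α p)
  φ_sq : ∀ p v, φ p (φ p v) = -v + ∑ α, η α p v • ξ α p
  η_ξ : ∀ α β p, η α p (ξ β p) = if α = β then 1 else 0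
  index_pos : 0 < g.index
  index_lt : g.index < Module.finrank ℝ E
  ε_eq : ∀ α, ε α = 1 ∨ ε α = -1
  g_ξ : ∀ α p, g.val p (ξ α p) (ξ α p) = ε α
  compat : ∀ p u v,
    g.val p (φ p u) (φ p v) = g.val p u v - ∑ α, ε α * (η α p u * η α p v)

/-- An indefinite metric globally framed `f`-structure is an indefinite `𝒮`-structure if it is
normal, `N_φ + 2 dη^α ⊗ ξ_α = 0`, and `dη^α = Φ` for all `α`, where `Φ(X, Y) = g(X, φY)`. -/
structure IndefiniteMetricGFF.IsSStructure {r : ℕ} (𝒮 : IndefiniteMetricGFF r E N) : Prop where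
  normal : ∀ X Y : ∀ p : N, TangentSpace 𝓘(ℝ, E) p,
    SmoothOn X Set.univ → SmoothOn Y Set.univ → ∀ p,
      nijenhuis 𝒮.φ X Y p + (2 : ℝ) • ∑ α, extDeriv (𝒮.η α) X Y p • 𝒮.ξ α p = 0
  extDeriv_η : ∀ α, ∀ X Y : ∀ p : N, TangentSpace 𝓘(ℝ, E) p,
    SmoothOn X Set.univ → SmoothOn Y Set.univ → ∀ p,
      extDeriv (𝒮.η α) X Y p = 𝒮.g.val p (X p) (𝒮.φ p (Y p))

/-- `φ` is skew-symmetric. -/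
theorem IndefiniteMetricGFF.skew {r : ℕ} (𝒮 : IndefiniteMetricGFF r E N) (p : N)
    (u v : TangentSpace 𝓘(ℝ, E) p) :
    𝒮.g.val p (𝒮.φ p u) v = -𝒮.g.val p u (𝒮.φ p v) := by
  have hφξ : ∀ α, 𝒮.φ p (𝒮.ξ α p) = 0 := by
    intro α
    have h : 𝒮.ξ α p ∈ LinearMap.ker (𝒮.φ p).toLinearMap := by
      rw [𝒮.ker_φ]
      exact Submodule.subset_span ⟨α, rfl⟩
    exact h
  have hηφ : ∀ w β, 𝒮.η β p (𝒮.φ p w) = 0 := by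
    intro w β
    have h1 := 𝒮.φ_sq p (𝒮.φ p w)
    rw [𝒮.φ_sq p w] at h1
    have h2 : ∑ α, 𝒮.η α p (𝒮.φ p w) • 𝒮.ξ α p = 0 := by
      simpa [hφξ] using h1
    simpa [𝒮.η_ξ] using congrArg (𝒮.η β p) h2
  have hφξ' : ∀ α, 𝒮.g.val p (𝒮.φ p u) (𝒮.ξ α p) = 0 := by
    intro α
    have h := 𝒮.compat p (𝒮.φ p u) (𝒮.ξ α p)
    simpa [hφξ, hηφ] using h.symm
  have h := 𝒮.compat p u (𝒮.φ p v)
  rw [𝒮.φ_sq p v] at h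
  simp [hηφ, hφξ'] at h
  linarith

end SManifold

/-! ## Characteristic lightlike hypersurfaces -/

section Hypersurface

variable {r : ℕ}
  {E : Type*} [NormedAddCommGroup E] [NormedSpace ℝ E]
  {N : Type*} [TopologicalSpace N] [ChartedSpace E N] [IsManifold 𝓘(ℝ, E) ∞ N]
  {F : Type*} [NormedAddCommGroup F] [NormedSpace ℝ F]
  {M : Type*} [TopologicalSpace M] [ChartedSpace F M]

/-- The differential of `i : M → N` at `x`. -/
def diff (E F : Type*) [NormedAddCommGroup E] [NormedSpace ℝ E] [NormedAddCommGroup F]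
    [NormedSpace ℝ F] {N : Type*} [TopologicalSpace N] [ChartedSpace E N]
    {M : Type*} [TopologicalSpace M] [ChartedSpace F M] (i : M → N) (x : M) :
    TangentSpace 𝓘(ℝ, F) x →ₗ[ℝ] TangentSpace 𝓘(ℝ, E) (i x) :=
  (mfderiv 𝓘(ℝ, F) 𝓘(ℝ, E) i x).toLinearMap

/-- `Rad(T_x M)`: the vectors of `T_x M` that are orthogonal to `T_x M`. -/
def radical (g : SemiRiemannianMetric E N) (i : M → N) (x : M) :
    Submodule ℝ (TangentSpace 𝓘(ℝ, F) x) where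
  carrier := {v | ∀ w, g.val (i x) (diff E F i x v) (diff E F i x w) = 0}
  add_mem' := fun ha hb w => by simp [ha w, hb w]
  zero_mem' := fun w => by simp
  smul_mem' := fun c a ha w => by simp [ha w]

/-- `i : M → N` is a lightlike hypersurface: an immersion of codimension one such that the
induced metric is degenerate at every point. -/
structure IsLightlikeHypersurface (E F : Type*) [NormedAddCommGroup E] [NormedSpace ℝ E]
    [NormedAddCommGroup F] [NormedSpace ℝ F]
    {N : Type*} [TopologicalSpace N] [ChartedSpace E N] [IsManifold 𝓘(ℝ, E) ∞ N]
    {M : Type*} [TopologicalSpace M] [ChartedSpace F M]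
    (g : SemiRiemannianMetric E N) (i : M → N) : Prop where
  smooth : ContMDiff 𝓘(ℝ, F) 𝓘(ℝ, E) ∞ i
  immersion : ∀ x, Function.Injective (diff E F i x)
  codim : Module.finrank ℝ F + 1 = Module.finrank ℝ E
  degenerate : ∀ x : M, radical (F := F) g i x ≠ ⊥

/-- The lightlike hypersurface is characteristic: all `ξ_α` are tangent to it. -/
def IsCharacteristic (F : Type*) [NormedAddCommGroup F] [NormedSpace ℝ F]
    {M : Type*} [TopologicalSpace M] [ChartedSpace F M]
    (𝒮 : IndefiniteMetricGFF r E N) (i : M → N) : Prop :=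
  ∀ α x, 𝒮.ξ α (i x) ∈ LinearMap.range (diff E F i x)

/-- `S` is a screen distribution: a distribution on `M` with `TM = Rad(TM) ⊕ S`. -/
structure IsScreen [IsManifold 𝓘(ℝ, F) ∞ M] (g : SemiRiemannianMetric E N) (i : M → N)
    (S : ∀ x : M, Submodule ℝ (TangentSpace 𝓘(ℝ, F) x)) : Prop where
  isDistribution : IsDistribution S
  isCompl : ∀ x, IsCompl (radical g i x) (S x)

/-- The screen distribution `S` is characteristic: `ker φ ⊆ S` and `φ(Rad(TM)) ⊆ S`. -/
structure IsCharacteristicScreen (𝒮 : IndefiniteMetricGFF r E N) (i : M → N)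
    (S : ∀ x : M, Submodule ℝ (TangentSpace 𝓘(ℝ, F) x)) : Prop where
  ker_le : ∀ x, LinearMap.ker (𝒮.φ (i x)).toLinearMap ≤ (S x).map (diff E F i x)
  φ_radical_le : ∀ x, ∀ e ∈ radical 𝒮.g i x,
    𝒮.φ (i x) (diff E F i x e) ∈ (S x).map (diff E F i x)

/-- `n` is the vector `N` attached to `e ∈ Rad(T_x M)`:
`g(N, E) = 1`, `g(N, N) = 0`, and `g(N, W) = 0` for `W ∈ S`. -/
structure IsTransversal (g : SemiRiemannianMetric E N) (i : M → N) (x : M)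
    (S : Submodule ℝ (TangentSpace 𝓘(ℝ, F) x)) (e : TangentSpace 𝓘(ℝ, F) x)
    (n : TangentSpace 𝓘(ℝ, E) (i x)) : Prop where
  pairing : g.val (i x) n (diff E F i x e) = 1
  null : g.val (i x) n n = 0
  orthogonal : ∀ w ∈ S, g.val (i x) n (diff E F i x w) = 0

/-- The lightlike transversal bundle `ltr(M)` at `x`. -/
def ltr (g : SemiRiemannianMetric E N) (i : M → N)
    (S : ∀ x : M, Submodule ℝ (TangentSpace 𝓘(ℝ, F) x)) (x : M) :
    Submodule ℝ (TangentSpace 𝓘(ℝ, E) (i x)) :=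
  Submodule.span ℝ {n | ∃ e ∈ radical g i x, IsTransversal g i x (S x) e n}

/-- The distribution `D₀`: the orthogonal complement of `φ(Rad(TM)) ⊕ φ(ltr(M))` in `S`. -/
def D₀ (𝒮 : IndefiniteMetricGFF r E N) (i : M → N)
    (S : ∀ x : M, Submodule ℝ (TangentSpace 𝓘(ℝ, F) x)) (x : M) :
    Submodule ℝ (TangentSpace 𝓘(ℝ, F) x) where
  carrier := {v | v ∈ S x ∧
    (∀ e ∈ radical 𝒮.g i x, 𝒮.g.val (i x) (diff E F i x v) (𝒮.φ (i x) (diff E F i x e)) = 0) ∧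
    ∀ n ∈ ltr 𝒮.g i S x, 𝒮.g.val (i x) (diff E F i x v) (𝒮.φ (i x) n) = 0}
  add_mem' := fun ha hb => ⟨add_mem ha.1 hb.1,
    fun e he => by simp [ha.2.1 e he, hb.2.1 e he],
    fun n hn => by simp [ha.2.2 n hn, hb.2.2 n hn]⟩
  zero_mem' := ⟨zero_mem _, fun e _ => by simp, fun n _ => by simp⟩
  smul_mem' := fun c a ha => ⟨Submodule.smul_mem _ c ha.1,
    fun e he => by simp [ha.2.1 e he], fun n hn => by simp [ha.2.2 n hn]⟩

/-- The tangential part: the component in `T_x M` of a vector of `T_{i x} N = T_x M ⊕ ltr(M)_x`. -/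
def tangentPart (g : SemiRiemannianMetric E N) (i : M → N)
    (S : ∀ x : M, Submodule ℝ (TangentSpace 𝓘(ℝ, F) x)) (x : M) :
    TangentSpace 𝓘(ℝ, E) (i x) →ₗ[ℝ] TangentSpace 𝓘(ℝ, F) x :=
  (diff E F i x).leftInverse ∘ₗ projAlong (LinearMap.range (diff E F i x)) (ltr g i S x)

/-- The tensor field `φ` that `φ̄` induces on `M`: the tangential part of `φ̄`. It coincides with
`φ̄` on `D₀`. -/
def inducedφ (𝒮 : IndefiniteMetricGFF r E N) (i : M → N)
    (S : ∀ x : M, Submodule ℝ (TangentSpace 𝓘(ℝ, F) x)) (x : M)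
    (v : TangentSpace 𝓘(ℝ, F) x) : TangentSpace 𝓘(ℝ, F) x :=
  tangentPart 𝒮.g i S x (𝒮.φ (i x) (diff E F i x v))

section SecondFundamentalForms

variable [FiniteDimensional ℝ E] (g : SemiRiemannianMetric E N) (i : M → N)
  (S : ∀ x : M, Submodule ℝ (TangentSpace 𝓘(ℝ, F) x))

/-- `∇̄_v Y` at `x`, for `v ∈ T_x M` and a vector field `Y` on `M`. -/
def ambientConnection (Y : ∀ x : M, TangentSpace 𝓘(ℝ, F) x) (x : M)
    (v : TangentSpace 𝓘(ℝ, F) x) : TangentSpace 𝓘(ℝ, E) (i x) :=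
  leviCivitaAlong g i (fun y => diff E F i y (Y y)) x v

/-- The induced connection: `∇_v Y` is the tangential part of `∇̄_v Y`. -/
def inducedConnection (Y : ∀ x : M, TangentSpace 𝓘(ℝ, F) x) (x : M)
    (v : TangentSpace 𝓘(ℝ, F) x) : TangentSpace 𝓘(ℝ, F) x :=
  tangentPart g i S x (ambientConnection g i Y x v)

/-- The second fundamental form of `M`: `h(v, Y)` is the component of `∇̄_v Y` in `ltr(M)`. -/
def secondForm (Y : ∀ x : M, TangentSpace 𝓘(ℝ, F) x) (x : M)
    (v : TangentSpace 𝓘(ℝ, F) x) : TangentSpace 𝓘(ℝ, E) (i x) :=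
  projAlong (ltr g i S x) (LinearMap.range (diff E F i x)) (ambientConnection g i Y x v)

/-- The second fundamental form of the screen distribution: `h*(v, Y)`, for `Y ∈ Γ(S)`, is the
component of `∇_v Y` in `Rad(TM)` with respect to `TM = Rad(TM) ⊕ S`. -/
def screenSecondForm (Y : ∀ x : M, TangentSpace 𝓘(ℝ, F) x) (x : M)
    (v : TangentSpace 𝓘(ℝ, F) x) : TangentSpace 𝓘(ℝ, F) x :=
  projAlong (radical g i x) (S x) (inducedConnection g i S Y x v)

/-- The local second fundamental form `B(X, Y) = g(h(X, Y), E)` of `M` at `x`, where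
`e = E x`. -/
def localB (e : ∀ x : M, TangentSpace 𝓘(ℝ, F) x)
    (X Y : ∀ x : M, TangentSpace 𝓘(ℝ, F) x) (x : M) : ℝ :=
  g.val (i x) (secondForm g i S Y x (X x)) (diff E F i x (e x))

/-- The local second fundamental form `C(X, Y) = g(h*(X, Y), N)` of the screen distribution at
`x`, for `Y ∈ Γ(S)`. -/
def localC (n : ∀ x : M, TangentSpace 𝓘(ℝ, E) (i x))
    (X Y : ∀ x : M, TangentSpace 𝓘(ℝ, F) x) (x : M) : ℝ :=
  g.val (i x) (diff E F i x (screenSecondForm g i S Y x (X x))) (n x)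

end SecondFundamentalForms

/-! The projections above are taken along decompositions that do hold. -/

theorem isCompl_range_span [FiniteDimensional ℝ E] [FiniteDimensional ℝ F]
    {g : SemiRiemannianMetric E N} {i : M → N}
    (hM : IsLightlikeHypersurface E F g i) {x : M} {S : Submodule ℝ (TangentSpace 𝓘(ℝ, F) x)}
    {e : TangentSpace 𝓘(ℝ, F) x} (he : e ∈ radical g i x)
    {n : TangentSpace 𝓘(ℝ, E) (i x)} (hn : IsTransversal g i x S e n) :
    IsCompl (LinearMap.range (diff E F i x)) (Submodule.span ℝ {n}) := by
  have : FiniteDimensional ℝ (TangentSpace 𝓘(ℝ, E) (i x)) :=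
    inferInstanceAs (FiniteDimensional ℝ E)
  have : FiniteDimensional ℝ (TangentSpace 𝓘(ℝ, F) x) :=
    inferInstanceAs (FiniteDimensional ℝ F)
  have hn0 : n ≠ 0 := by
    rintro rfl
    simpa using hn.pairing
  have hd : Disjoint (LinearMap.range (diff E F i x)) (Submodule.span ℝ {n}) := by
    rw [Submodule.disjoint_def]
    rintro _ ⟨w, rfl⟩ hw
    obtain ⟨a, ha⟩ := Submodule.mem_span_singleton.1 hw
    have h1 := he w
    rw [g.symm, ← ha] at h1
    have h2 : a = 0 := by simpa [hn.pairing] using h1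
    rw [← ha, h2, zero_smul]
  refine ⟨hd, codisjoint_iff.2 (Submodule.eq_top_of_finrank_eq ?_)⟩
  have h := Submodule.finrank_sup_add_finrank_inf_eq (LinearMap.range (diff E F i x))
    (Submodule.span ℝ {n})
  rw [hd.eq_bot, finrank_bot, LinearMap.finrank_range_of_inj (hM.immersion x),
    finrank_span_singleton hn0] at h
  have h3 : Module.finrank ℝ (TangentSpace 𝓘(ℝ, F) x) = Module.finrank ℝ F := rfl
  have h4 : Module.finrank ℝ (TangentSpace 𝓘(ℝ, E) (i x)) = Module.finrank ℝ E := rfl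
  have := hM.codim
  omega

/-- `ltr(M)` is the line bundle spanned by `N`. -/
theorem ltr_eq_span [FiniteDimensional ℝ E] [FiniteDimensional ℝ F]
    {g : SemiRiemannianMetric E N} {i : M → N}
    (hM : IsLightlikeHypersurface E F g i)
    {S : ∀ x : M, Submodule ℝ (TangentSpace 𝓘(ℝ, F) x)} {x : M}
    (hS : IsCompl (radical g i x) (S x))
    {e : TangentSpace 𝓘(ℝ, F) x} (he : e ∈ radical g i x)
    {n : TangentSpace 𝓘(ℝ, E) (i x)} (hn : IsTransversal g i x (S x) e n) :
    ltr g i S x = Submodule.span ℝ {n} := by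
  have hc := isCompl_range_span hM he hn
  have dec : ∀ d : TangentSpace 𝓘(ℝ, E) (i x), ∃ w, ∃ a : ℝ, d = diff E F i x w + a • n := by
    intro d
    have hd : d ∈ LinearMap.range (diff E F i x) ⊔ Submodule.span ℝ {n} := by
      rw [hc.sup_eq_top]; trivial
    obtain ⟨_, ⟨w, rfl⟩, y, hy, h⟩ := Submodule.mem_sup.1 hd
    obtain ⟨a, rfl⟩ := Submodule.mem_span_singleton.1 hy
    exact ⟨w, a, h.symm⟩
  have hrad : ∀ e' ∈ radical g i x, ∃ c : ℝ, e' = c • e := by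
    intro e' he'
    refine ⟨g.val (i x) n (diff E F i x e'), sub_eq_zero.1 (hM.immersion x ?_)⟩
    rw [map_zero]
    apply g.nondegenerate (i x)
    intro d
    obtain ⟨w, a, rfl⟩ := dec d
    have h1 := he w
    have h2 := he' w
    have h3 := hn.pairing
    rw [g.symm] at h3
    simp [h1, h2, h3, g.symm (i x) (diff E F i x e') n]
    ring
  apply le_antisymm
  · rw [ltr, Submodule.span_le]
    rintro n' ⟨e', he', hn'⟩
    obtain ⟨c, rfl⟩ := hrad e' he'
    have hp := hn'.pairing
    have hp' : c * g.val (i x) n' (diff E F i x e) = 1 := by simpa using hp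
    have hc0 : c ≠ 0 := by rintro rfl; simp at hp'
    obtain ⟨w, a, hw⟩ := dec (n' - c⁻¹ • n)
    have horth : ∀ z, g.val (i x) (n' - c⁻¹ • n) (diff E F i x z) = 0 := by
      intro z
      have hz : z ∈ radical g i x ⊔ S x := by rw [hS.sup_eq_top]; trivial
      obtain ⟨z₁, hz₁, z₂, hz₂, rfl⟩ := Submodule.mem_sup.1 hz
      obtain ⟨b, rfl⟩ := hrad z₁ hz₁
      have h1 : g.val (i x) n' (diff E F i x e) = c⁻¹ := by
        field_simp
        linarith
      simp [hn.orthogonal z₂ hz₂, hn'.orthogonal z₂ hz₂, hn.pairing, h1]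
      ring
    have ha : a = 0 := by
      have h1 := horth e
      have h2 := he w
      rw [g.symm] at h2
      rw [hw] at h1
      simpa [h2, hn.pairing] using h1
    have hwr : w ∈ radical g i x := by
      intro z
      have h1 := horth z
      rw [hw, ha] at h1
      simpa using h1
    obtain ⟨b, rfl⟩ := hrad w hwr
    have hn'eq : n' = c⁻¹ • n + b • diff E F i x e := by
      rw [ha, zero_smul, add_zero, map_smul] at hw
      rw [← hw]
      abel
    have h0 := hn'.null
    have h3 := hn.pairing
    rw [g.symm] at h3
    have h4 := he e
    rw [hn'eq] at h0
    simp [hn.null, hn.pairing, h3, h4] at h0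
    have hb : b = 0 := by
      field_simp at h0
      linarith
    rw [hn'eq, hb, zero_smul, add_zero]
    exact Submodule.smul_mem _ _ (Submodule.mem_span_singleton_self n)
  · rw [Submodule.span_singleton_le_iff_mem]
    exact Submodule.subset_span ⟨e, he, hn⟩

/-- On `D₀` the induced tensor field is `φ̄` itself. -/
theorem diff_inducedφ [FiniteDimensional ℝ E] [FiniteDimensional ℝ F]
    {𝒮 : IndefiniteMetricGFF r E N} {i : M → N}
    (hM : IsLightlikeHypersurface E F 𝒮.g i)
    {S : ∀ x : M, Submodule ℝ (TangentSpace 𝓘(ℝ, F) x)} {x : M}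
    (hS : IsCompl (radical 𝒮.g i x) (S x))
    {e : TangentSpace 𝓘(ℝ, F) x} (he : e ∈ radical 𝒮.g i x)
    {n : TangentSpace 𝓘(ℝ, E) (i x)} (hn : IsTransversal 𝒮.g i x (S x) e n)
    {v : TangentSpace 𝓘(ℝ, F) x} (hv : v ∈ D₀ 𝒮 i S x) :
    diff E F i x (inducedφ 𝒮 i S x v) = 𝒮.φ (i x) (diff E F i x v) := by
  have hc := isCompl_range_span hM he hn
  have hmem : 𝒮.φ (i x) (diff E F i x v) ∈ LinearMap.range (diff E F i x) := by
    have hd : 𝒮.φ (i x) (diff E F i x v) ∈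
        LinearMap.range (diff E F i x) ⊔ Submodule.span ℝ {n} := by
      rw [hc.sup_eq_top]; trivial
    obtain ⟨_, ⟨w, rfl⟩, y, hy, h⟩ := Submodule.mem_sup.1 hd
    obtain ⟨a, rfl⟩ := Submodule.mem_span_singleton.1 hy
    have h1 : 𝒮.g.val (i x) (𝒮.φ (i x) (diff E F i x v)) (diff E F i x e) = a := by
      have h2 := he w
      rw [𝒮.g.symm] at h2
      rw [← h]
      simp [h2, hn.pairing]
    have h2 : a = 0 := by
      rw [← h1, 𝒮.skew, hv.2.1 e he, neg_zero]
    exact ⟨w, by rw [← h, h2, zero_smul, add_zero]⟩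
  obtain ⟨w, hw⟩ := hmem
  have hl : IsCompl (LinearMap.range (diff E F i x)) (ltr 𝒮.g i S x) := by
    rw [ltr_eq_span hM hS he hn]
    exact hc
  rw [inducedφ, ← hw, tangentPart, LinearMap.comp_apply, projAlong, dif_pos hl,
    Submodule.projection_apply_of_mem_left hl (LinearMap.mem_range_self _ w),
    LinearMap.leftInverse_apply_of_inj (LinearMap.ker_eq_bot.2 (hM.immersion x))]

end Hypersurface

end Lightlike

end

/-!
Let `A(u, v, w) = g((∇̄_u φ) v, w)`. Three identities hold for an indefinite `𝒮`-structure: `A` is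
skew in its last two arguments, because `φ` is skew for `g`; its cyclic sum vanishes, because
`Φ = dη^α` is closed; and normality expresses `A(φu, v, w) - A(φv, u, w) + A(v, φw, u) - A(u, φw, v)`
through `Φ` and the `ξ_α`. Together they determine `A(φu, v, w)` (`IsSStructure.nablaφ_φ`). A
vector `z` orthogonal to all `ξ_α` is in the image of `φ`, so `A(z, u, v) = 0` for `u`, `v`
orthogonal to `z` (`IsSStructure.nablaφ_eq_zero`), and hence `A(u, v, z) = A(v, u, z)`
(`IsSStructure.nablaφ_comm`).

For `X, Y ∈ Γ(D₀)` and `z ∈ {E, N}` this cancels the terms in `∇̄φ`. As the Levi-Civita connection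
along the immersion has no torsion, `g([X, Y], φz) = g(∇̄_Y φX - ∇̄_X φY, z)`
(`metric_mlieBracket_φ`) and `g([X, Y], N) = g(∇̄_X Y - ∇̄_Y X, N)`. On the other hand
`B(X, Y) = g(∇̄_X Y, E)` and `C(X, Y) = g(∇̄_X Y, N)` (`localB_eq`, `localC_eq`), and a tangent
vector is in `D₀` exactly when it is orthogonal to `N`, `φE` and `φN` (`mem_D₀_iff`). So
`[X, Y] ∈ D₀` means `C(X, Y) = C(Y, X)`, `B(X, φY) = B(Y, φX)` and `C(X, φY) = C(Y, φX)`. The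
arguments on the right-hand sides may be interchanged: `B` is symmetric, and `D₀` is invariant
under `φ`, so that the first condition applies to the pair `φX`, `Y` as well.

The connection is given in coordinates. Its properties are derived from the commutator formula
`mvfderiv_mlieBracket` and from the coordinate fields of the chart at a point, which extend to
global smooth fields near that point by bump functions.
-/

noncomputable section

namespace Lightlike

/-! ### Derivatives of vector-valued functions and Lie brackets -/

section Calculus

variable {F : Type*} [NormedAddCommGroup F] [NormedSpace ℝ F]
  {M : Type*} [TopologicalSpace M] [ChartedSpace F M]
  {V : Type*} [NormedAddCommGroup V] [NormedSpace ℝ V]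
  {W : Type*} [NormedAddCommGroup W] [NormedSpace ℝ W]

theorem mvfderiv_congr {f f' : M → V} {x : M} (h : f =ᶠ[𝓝 x] f') :
    mvfderiv 𝓘(ℝ, F) f x = mvfderiv 𝓘(ℝ, F) f' x := by
  ext v
  exact DFunLike.congr_fun h.mfderiv_eq v

theorem mvfderiv_comp_fderiv {h : V → W} {f : M → V} {x : M} (hh : DifferentiableAt ℝ h (f x))
    (hf : MDifferentiableAt 𝓘(ℝ, F) 𝓘(ℝ, V) f x) (v : TangentSpace 𝓘(ℝ, F) x) :
    mvfderiv 𝓘(ℝ, F) (fun y => h (f y)) x v = fderiv ℝ h (f x) (mvfderiv 𝓘(ℝ, F) f x v) := by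
  have := mfderiv_comp_apply x hh.mdifferentiableAt hf v
  rw [mfderiv_eq_fderiv] at this
  exact this

theorem mvfderiv_clm {f : M → V} {x : M} (L : V →L[ℝ] W)
    (hf : MDifferentiableAt 𝓘(ℝ, F) 𝓘(ℝ, V) f x) (v : TangentSpace 𝓘(ℝ, F) x) :
    mvfderiv 𝓘(ℝ, F) (fun y => L (f y)) x v = L (mvfderiv 𝓘(ℝ, F) f x v) := by
  rw [mvfderiv_comp_fderiv L.differentiableAt hf, L.fderiv]

theorem mvfderiv_clm_apply {c : M → V →L[ℝ] W} {f : M → V} {x : M}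
    (hc : MDifferentiableAt 𝓘(ℝ, F) 𝓘(ℝ, V →L[ℝ] W) c x)
    (hf : MDifferentiableAt 𝓘(ℝ, F) 𝓘(ℝ, V) f x) (v : TangentSpace 𝓘(ℝ, F) x) :
    mvfderiv 𝓘(ℝ, F) (fun y => c y (f y)) x v =
      mvfderiv 𝓘(ℝ, F) c x v (f x) + c x (mvfderiv 𝓘(ℝ, F) f x v) := by
  have hb := isBoundedBilinearMap_apply (𝕜 := ℝ) (E := V) (F := W)
  have hp : MDifferentiableAt 𝓘(ℝ, F) 𝓘(ℝ, (V →L[ℝ] W) × V) (fun y => (c y, f y)) x := by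
    exact hc.prodMk_space hf
  have h1 := mvfderiv_comp_fderiv (h := fun p : (V →L[ℝ] W) × V => p.1 p.2)
    (f := fun y => (c y, f y)) (hb.differentiableAt (c x, f x)) hp v
  rw [h1, hb.fderiv, hb.deriv_apply]
  have h2 : mvfderiv 𝓘(ℝ, F) c x v = (mvfderiv 𝓘(ℝ, F) (fun y => (c y, f y)) x v).1 :=
    mvfderiv_clm (ContinuousLinearMap.fst ℝ (V →L[ℝ] W) V) hp v
  have h3 : mvfderiv 𝓘(ℝ, F) f x v = (mvfderiv 𝓘(ℝ, F) (fun y => (c y, f y)) x v).2 :=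
    mvfderiv_clm (ContinuousLinearMap.snd ℝ (V →L[ℝ] W) V) hp v
  rw [h2, h3, add_comm]

/-- The vector field `Z`, read in the preferred chart at `x`. -/
def chartPullback (x : M) (Z : ∀ y : M, TangentSpace 𝓘(ℝ, F) y) : F → F :=
  VectorField.mpullbackWithin 𝓘(ℝ, F) 𝓘(ℝ, F) (extChartAt 𝓘(ℝ, F) x).symm Z (Set.range 𝓘(ℝ, F))

theorem eventuallyEq_comp_extChartAt {V : Type*} (f : M → V) {x y : M}
    (hy : y ∈ (extChartAt 𝓘(ℝ, F) x).source) :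
    f =ᶠ[𝓝 y] fun y' => (f ∘ (extChartAt 𝓘(ℝ, F) x).symm) (extChartAt 𝓘(ℝ, F) x y') := by
  filter_upwards [(isOpen_extChartAt_source x).mem_nhds hy] with y' hy'
  rw [Function.comp_apply, (extChartAt 𝓘(ℝ, F) x).left_inv hy']

theorem contDiffAt_comp_extChartAt_symm {f : M → V} {x : M} {k : WithTop ℕ∞}
    (hf : ContMDiffAt 𝓘(ℝ, F) 𝓘(ℝ, V) k f x) :
    ContDiffAt ℝ k (f ∘ (extChartAt 𝓘(ℝ, F) x).symm) (extChartAt 𝓘(ℝ, F) x x) := by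
  have := (contMDiffAt_iff.1 hf).2
  simpa using! this

variable [IsManifold 𝓘(ℝ, F) ∞ M]

theorem mdifferentiableAt_extChartAt_of_mem_source {x y : M}
    (hy : y ∈ (extChartAt 𝓘(ℝ, F) x).source) :
    MDifferentiableAt 𝓘(ℝ, F) 𝓘(ℝ, F) (extChartAt 𝓘(ℝ, F) x) y :=
  mdifferentiableAt_extChartAt (by simpa using! hy)

theorem mvfderiv_extChartAt_apply (Z : ∀ y : M, TangentSpace 𝓘(ℝ, F) y) {x y : M}
    (hy : y ∈ (extChartAt 𝓘(ℝ, F) x).source) :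
    mvfderiv 𝓘(ℝ, F) (extChartAt 𝓘(ℝ, F) x) y (Z y) =
      chartPullback x Z (extChartAt 𝓘(ℝ, F) x y) := by
  set ψ := extChartAt 𝓘(ℝ, F) x with hψ
  obtain ⟨z, hz, rfl⟩ : ∃ z ∈ ψ.target, ψ.symm z = y := ⟨ψ y, ψ.map_source hy, ψ.left_inv hy⟩
  have h1 := mfderiv_extChartAt_comp_mfderivWithin_extChartAt_symm (I := 𝓘(ℝ, F)) hz
  have h2 := mfderivWithin_extChartAt_symm_comp_mfderiv_extChartAt (I := 𝓘(ℝ, F)) hz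
  have h3 := ContinuousLinearMap.inverse_eq h2 h1
  rw [ψ.right_inv hz, chartPullback, VectorField.mpullbackWithin_apply]
  exact (DFunLike.congr_fun h3 (Z (ψ.symm z))).symm

theorem differentiableAt_chartPullback [CompleteSpace F] {x : M}
    {Z : ∀ y : M, TangentSpace 𝓘(ℝ, F) y}
    (hZ : MDifferentiableAt 𝓘(ℝ, F) 𝓘(ℝ, F).tangent
      (fun y => (⟨y, Z y⟩ : TangentBundle 𝓘(ℝ, F) M)) x) :
    DifferentiableAt ℝ (chartPullback x Z) (extChartAt 𝓘(ℝ, F) x x) := by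
  have := (mdifferentiableWithinAt_univ.2 hZ).differentiableWithinAt_mpullbackWithin_vectorField
  rw [← differentiableWithinAt_univ]
  convert! this using 1
  simp

theorem mvfderiv_apply_eventuallyEq {f : M → V} {x : M}
    (hf : ContMDiffAt 𝓘(ℝ, F) 𝓘(ℝ, V) 2 f x) (Z : ∀ y : M, TangentSpace 𝓘(ℝ, F) y) :
    (fun y => mvfderiv 𝓘(ℝ, F) f y (Z y)) =ᶠ[𝓝 x] fun y =>
      fderiv ℝ (f ∘ (extChartAt 𝓘(ℝ, F) x).symm) (extChartAt 𝓘(ℝ, F) x y)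
        (chartPullback x Z (extChartAt 𝓘(ℝ, F) x y)) := by
  have h1 : ∀ᶠ z in 𝓝 (extChartAt 𝓘(ℝ, F) x x),
      DifferentiableAt ℝ (f ∘ (extChartAt 𝓘(ℝ, F) x).symm) z := by
    filter_upwards [(contDiffAt_comp_extChartAt_symm hf).eventually (by simp)] with z hz
    exact hz.differentiableAt (by simp)
  filter_upwards [extChartAt_source_mem_nhds (I := 𝓘(ℝ, F)) x,
    (continuousAt_extChartAt x).eventually h1] with y hy hy2
  rw [mvfderiv_congr (eventuallyEq_comp_extChartAt f hy),
    mvfderiv_comp_fderiv hy2 (mdifferentiableAt_extChartAt_of_mem_source hy),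
    mvfderiv_extChartAt_apply Z hy]

theorem differentiableAt_fderiv_chartPullback [CompleteSpace F] {f : M → V} {x : M}
    (hf : ContMDiffAt 𝓘(ℝ, F) 𝓘(ℝ, V) 2 f x) {Z : ∀ y : M, TangentSpace 𝓘(ℝ, F) y}
    (hZ : MDifferentiableAt 𝓘(ℝ, F) 𝓘(ℝ, F).tangent
      (fun y => (⟨y, Z y⟩ : TangentBundle 𝓘(ℝ, F) M)) x) :
    DifferentiableAt ℝ (fun z => fderiv ℝ (f ∘ (extChartAt 𝓘(ℝ, F) x).symm) z
      (chartPullback x Z z)) (extChartAt 𝓘(ℝ, F) x x) :=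
  (((contDiffAt_comp_extChartAt_symm hf).fderiv_right (m := 1) (by norm_num)).differentiableAt
    (by simp)).clm_apply (differentiableAt_chartPullback hZ)

theorem mdifferentiableAt_mvfderiv_apply [CompleteSpace F] {f : M → V} {x : M}
    (hf : ContMDiffAt 𝓘(ℝ, F) 𝓘(ℝ, V) 2 f x) {Z : ∀ y : M, TangentSpace 𝓘(ℝ, F) y}
    (hZ : MDifferentiableAt 𝓘(ℝ, F) 𝓘(ℝ, F).tangent
      (fun y => (⟨y, Z y⟩ : TangentBundle 𝓘(ℝ, F) M)) x) :
    MDifferentiableAt 𝓘(ℝ, F) 𝓘(ℝ, V) (fun y => mvfderiv 𝓘(ℝ, F) f y (Z y)) x :=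
  ((differentiableAt_fderiv_chartPullback hf hZ).mdifferentiableAt.comp x
    (mdifferentiableAt_extChartAt_of_mem_source (mem_extChartAt_source x))).congr_of_eventuallyEq
      (mvfderiv_apply_eventuallyEq hf Z)

theorem mvfderiv_extChartAt_mlieBracket (X Y : ∀ y : M, TangentSpace 𝓘(ℝ, F) y) (x : M) :
    mvfderiv 𝓘(ℝ, F) (extChartAt 𝓘(ℝ, F) x) x (VectorField.mlieBracket 𝓘(ℝ, F) X Y x) =
      VectorField.lieBracket ℝ (chartPullback x X) (chartPullback x Y)
        (extChartAt 𝓘(ℝ, F) x x) := by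
  rw [VectorField.mlieBracket, VectorField.mlieBracketWithin_apply, Set.preimage_univ,
    Set.univ_inter]
  have hinv := isInvertible_mfderiv_extChartAt (I := 𝓘(ℝ, F)) (mem_extChartAt_source x)
  have hr : Set.range 𝓘(ℝ, F) = Set.univ := by simp
  refine (hinv.self_apply_inverse _).trans ?_
  rw [← VectorField.lieBracketWithin_univ, ← hr]
  rfl

/-- The differentiation operator along `[X, Y]` is the commutator of the differentiation operators
along `X` and `Y`. -/
theorem mvfderiv_mlieBracket [CompleteSpace F] {f : M → V} {x : M}
    (hf : ContMDiffAt 𝓘(ℝ, F) 𝓘(ℝ, V) 2 f x) {X Y : ∀ y : M, TangentSpace 𝓘(ℝ, F) y}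
    (hX : MDifferentiableAt 𝓘(ℝ, F) 𝓘(ℝ, F).tangent
      (fun y => (⟨y, X y⟩ : TangentBundle 𝓘(ℝ, F) M)) x)
    (hY : MDifferentiableAt 𝓘(ℝ, F) 𝓘(ℝ, F).tangent
      (fun y => (⟨y, Y y⟩ : TangentBundle 𝓘(ℝ, F) M)) x) :
    mvfderiv 𝓘(ℝ, F) f x (VectorField.mlieBracket 𝓘(ℝ, F) X Y x) =
      mvfderiv 𝓘(ℝ, F) (fun y => mvfderiv 𝓘(ℝ, F) f y (Y y)) x (X x)
        - mvfderiv 𝓘(ℝ, F) (fun y => mvfderiv 𝓘(ℝ, F) f y (X y)) x (Y x) := by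
  have hx := mem_extChartAt_source (I := 𝓘(ℝ, F)) x
  have hψ := mdifferentiableAt_extChartAt_of_mem_source hx
  have hfh := contDiffAt_comp_extChartAt_symm hf
  rw [mvfderiv_congr (mvfderiv_apply_eventuallyEq hf X),
    mvfderiv_congr (mvfderiv_apply_eventuallyEq hf Y),
    mvfderiv_comp_fderiv (differentiableAt_fderiv_chartPullback hf hX) hψ,
    mvfderiv_comp_fderiv (differentiableAt_fderiv_chartPullback hf hY) hψ,
    mvfderiv_extChartAt_apply X hx, mvfderiv_extChartAt_apply Y hx,
    mvfderiv_congr (eventuallyEq_comp_extChartAt f hx),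
    mvfderiv_comp_fderiv (hfh.differentiableAt (by simp)) hψ, mvfderiv_extChartAt_mlieBracket]
  exact VectorField.fderiv_apply_lieBracket hfh (by simp) (differentiableAt_chartPullback hY)
    (differentiableAt_chartPullback hX)

end Calculus

/-! ### Coordinates of tangent vectors -/

section Frames

variable {E : Type*} [NormedAddCommGroup E] [NormedSpace ℝ E]
  {N : Type*} [TopologicalSpace N] [ChartedSpace E N]

/-- The domain of the preferred chart at `p`. -/
def chartDomain (E : Type*) [NormedAddCommGroup E] [NormedSpace ℝ E]
    {N : Type*} [TopologicalSpace N] [ChartedSpace E N] (p : N) : Set N :=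
  (chartAt E p).source

theorem isOpen_chartDomain (p : N) : IsOpen (chartDomain E p) := (chartAt E p).open_source

theorem mem_chartDomain (p : N) : p ∈ chartDomain E p := mem_chart_source E p

theorem eventually_mem_chartDomain (p : N) : ∀ᶠ q in 𝓝 p, q ∈ chartDomain E p :=
  (isOpen_chartDomain p).mem_nhds (mem_chartDomain p)

variable [IsManifold 𝓘(ℝ, E) ∞ N]

/-- The coordinates of a tangent vector at `q` in the preferred chart at `p`. -/
def coordAt (p q : N) : TangentSpace 𝓘(ℝ, E) q →L[ℝ] E :=
  (trivializationAt E (TangentSpace 𝓘(ℝ, E) : N → Type _) p).continuousLinearMapAt ℝ q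

/-- The tangent vector at `q` with given coordinates in the preferred chart at `p`. -/
def ofCoord (p q : N) : E →L[ℝ] TangentSpace 𝓘(ℝ, E) q :=
  (trivializationAt E (TangentSpace 𝓘(ℝ, E) : N → Type _) p).symmL ℝ q

theorem ofCoord_coordAt {p q : N} (hq : q ∈ chartDomain E p) (v : TangentSpace 𝓘(ℝ, E) q) :
    ofCoord p q (coordAt p q v) = v :=
  (trivializationAt E (TangentSpace 𝓘(ℝ, E) : N → Type _) p).symmL_continuousLinearMapAt hq v

theorem coordAt_ofCoord {p q : N} (hq : q ∈ chartDomain E p) (a : E) :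
    coordAt p q (ofCoord p q a) = a :=
  (trivializationAt E (TangentSpace 𝓘(ℝ, E) : N → Type _) p).continuousLinearMapAt_symmL hq a

theorem coordField_eq (p q : N) (u : TangentSpace 𝓘(ℝ, E) p) :
    coordField p u q = ofCoord p q (coordAt p p u) := rfl

@[simp]
theorem coordField_self (p : N) (u : TangentSpace 𝓘(ℝ, E) p) : coordField p u p = u :=
  ofCoord_coordAt (mem_chartDomain p) u

theorem coordAt_eq_mvfderiv {p q : N} (hq : q ∈ chartDomain E p) (v : TangentSpace 𝓘(ℝ, E) q) :
    coordAt p q v = mvfderiv 𝓘(ℝ, E) (extChartAt 𝓘(ℝ, E) p) q v :=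
  DFunLike.congr_fun (TangentBundle.continuousLinearMapAt_trivializationAt (I := 𝓘(ℝ, E)) hq) v

theorem trivializationAt_snd {p q : N} (hq : q ∈ chartDomain E p) (v : TangentSpace 𝓘(ℝ, E) q) :
    (trivializationAt E (TangentSpace 𝓘(ℝ, E) : N → Type _) p ⟨q, v⟩).2 = coordAt p q v := by
  rw [coordAt, Trivialization.continuousLinearMapAt_apply, Trivialization.coe_linearMapAt_of_mem]
  exact hq

variable {F : Type*} [NormedAddCommGroup F] [NormedSpace ℝ F]
  {M : Type*} [TopologicalSpace M] [ChartedSpace F M]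

/-- A vector field along `i` is differentiable at `x` if and only if its coordinates in the chart at
`i x` are. -/
theorem mdifferentiableAt_along_iff {i : M → N} {x : M}
    (hi : MDifferentiableAt 𝓘(ℝ, F) 𝓘(ℝ, E) i x) (W : ∀ x, TangentSpace 𝓘(ℝ, E) (i x)) :
    MDifferentiableAt 𝓘(ℝ, F) 𝓘(ℝ, E).tangent
      (fun y => (⟨i y, W y⟩ : TangentBundle 𝓘(ℝ, E) N)) x ↔
    MDifferentiableAt 𝓘(ℝ, F) 𝓘(ℝ, E) (fun y => coordAt (i x) (i y) (W y)) x := by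
  rw [mdifferentiableAt_totalSpace]
  have h : (fun y => (trivializationAt E (TangentSpace 𝓘(ℝ, E) : N → Type _) (i x)
      (⟨i y, W y⟩ : TangentBundle 𝓘(ℝ, E) N)).2) =ᶠ[𝓝 x]
      fun y => coordAt (i x) (i y) (W y) := by
    filter_upwards [hi.continuousAt.eventually (eventually_mem_chartDomain (E := E) (i x))] with y hy
    exact trivializationAt_snd hy _
  exact ⟨fun hh => hh.2.congr_of_eventuallyEq h.symm,
    fun hh => ⟨hi, hh.congr_of_eventuallyEq h⟩⟩

theorem contMDiffAt_along_iff {i : M → N} {x : M}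
    (hi : ContMDiffAt 𝓘(ℝ, F) 𝓘(ℝ, E) ∞ i x) (W : ∀ x, TangentSpace 𝓘(ℝ, E) (i x)) :
    ContMDiffAt 𝓘(ℝ, F) 𝓘(ℝ, E).tangent ∞
      (fun y => (⟨i y, W y⟩ : TangentBundle 𝓘(ℝ, E) N)) x ↔
    ContMDiffAt 𝓘(ℝ, F) 𝓘(ℝ, E) ∞ (fun y => coordAt (i x) (i y) (W y)) x := by
  rw [contMDiffAt_totalSpace]
  have h : (fun y => (trivializationAt E (TangentSpace 𝓘(ℝ, E) : N → Type _) (i x)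
      (⟨i y, W y⟩ : TangentBundle 𝓘(ℝ, E) N)).2) =ᶠ[𝓝 x]
      fun y => coordAt (i x) (i y) (W y) := by
    filter_upwards [hi.continuousAt.eventually (eventually_mem_chartDomain (E := E) (i x))] with y hy
    exact trivializationAt_snd hy _
  exact ⟨fun hh => hh.2.congr_of_eventuallyEq h.symm,
    fun hh => ⟨hi, hh.congr_of_eventuallyEq h⟩⟩

theorem mdifferentiableAt_iff_coordAt {p : N} (V : ∀ q : N, TangentSpace 𝓘(ℝ, E) q) :
    MDifferentiableAt 𝓘(ℝ, E) 𝓘(ℝ, E).tangent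
      (fun q => (⟨q, V q⟩ : TangentBundle 𝓘(ℝ, E) N)) p ↔
    MDifferentiableAt 𝓘(ℝ, E) 𝓘(ℝ, E) (fun q => coordAt p q (V q)) p :=
  mdifferentiableAt_along_iff (i := fun q : N => q) mdifferentiableAt_id V

theorem contMDiffAt_iff_coordAt {p : N} (V : ∀ q : N, TangentSpace 𝓘(ℝ, E) q) :
    ContMDiffAt 𝓘(ℝ, E) 𝓘(ℝ, E).tangent ∞
      (fun q => (⟨q, V q⟩ : TangentBundle 𝓘(ℝ, E) N)) p ↔
    ContMDiffAt 𝓘(ℝ, E) 𝓘(ℝ, E) ∞ (fun q => coordAt p q (V q)) p :=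
  contMDiffAt_along_iff (i := fun q : N => q) contMDiffAt_id V

end Frames

/-! ### The metric and the Levi-Civita connection -/

section LeviCivita

variable {E : Type*} [NormedAddCommGroup E] [NormedSpace ℝ E]
  {N : Type*} [TopologicalSpace N] [ChartedSpace E N] [IsManifold 𝓘(ℝ, E) ∞ N]
  {F : Type*} [NormedAddCommGroup F] [NormedSpace ℝ F]
  {M : Type*} [TopologicalSpace M] [ChartedSpace F M]
  (g : SemiRiemannianMetric E N)

theorem SemiRiemannianMetric.ext_left {g : SemiRiemannianMetric E N} {p : N}
    {u v : TangentSpace 𝓘(ℝ, E) p}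
    (h : ∀ z, g.val p u z = g.val p v z) : u = v :=
  sub_eq_zero.1 (g.nondegenerate p _ fun z => by simp [h z])

/-- The metric at `q`, as a bilinear form in the coordinates of the preferred chart at `p`. -/
def metricCoord (p q : N) : E →L[ℝ] E →L[ℝ] ℝ :=
  ContinuousLinearMap.inCoordinates E (TangentSpace 𝓘(ℝ, E) : N → Type _) (E →L[ℝ] ℝ)
    (fun p : N => TangentSpace 𝓘(ℝ, E) p →L[ℝ] ℝ) p q p q (g.val q)

theorem metricCoord_apply {p q : N} (hq : q ∈ chartDomain E p) (a b : E) :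
    metricCoord g p q a b = g.val q (ofCoord p q a) (ofCoord p q b) := by
  have := inCoordinates_apply_eq₂ (𝕜 := ℝ) (F₁ := E) (F₂ := E) (F₃ := ℝ)
    (E₁ := (TangentSpace 𝓘(ℝ, E) : N → Type _)) (E₂ := (TangentSpace 𝓘(ℝ, E) : N → Type _))
    (E₃ := Bundle.Trivial N ℝ) (x₀ := p) (x := q) (ϕ := g.val q) (v := a) (w := b)
    hq hq (Set.mem_univ _)
  rw [Trivialization.coe_linearMapAt_of_mem _ (Set.mem_univ _)] at this
  rw [ofCoord, Trivialization.symmL_apply _ hq, Trivialization.symmL_apply _ hq]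
  simpa using! this

theorem mdifferentiableAt_metricCoord (p : N) :
    MDifferentiableAt 𝓘(ℝ, E) 𝓘(ℝ, E →L[ℝ] E →L[ℝ] ℝ) (metricCoord g p) p :=
  ((mdifferentiableAt_hom_bundle _).1 ((g.smooth p).mdifferentiableAt (by simp))).2

theorem metric_eq_metricCoord {p q : N} (hq : q ∈ chartDomain E p) (u v : TangentSpace 𝓘(ℝ, E) q) :
    g.val q u v = metricCoord g p q (coordAt p q u) (coordAt p q v) := by
  rw [metricCoord_apply g hq, ofCoord_coordAt hq, ofCoord_coordAt hq]

theorem mdifferentiableAt_metric {p : N} {V W : ∀ q : N, TangentSpace 𝓘(ℝ, E) q}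
    (hV : MDifferentiableAt 𝓘(ℝ, E) 𝓘(ℝ, E).tangent
      (fun q => (⟨q, V q⟩ : TangentBundle 𝓘(ℝ, E) N)) p)
    (hW : MDifferentiableAt 𝓘(ℝ, E) 𝓘(ℝ, E).tangent
      (fun q => (⟨q, W q⟩ : TangentBundle 𝓘(ℝ, E) N)) p) :
    MDifferentiableAt 𝓘(ℝ, E) 𝓘(ℝ, ℝ) (fun q => g.val q (V q) (W q)) p := by
  rw [mdifferentiableAt_iff_coordAt] at hV hW
  refine (((mdifferentiableAt_metricCoord g p).clm_apply hV).clm_apply hW).congr_of_eventuallyEq ?_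
  filter_upwards [eventually_mem_chartDomain (E := E) p] with q hq
  exact metric_eq_metricCoord g hq _ _

variable [FiniteDimensional ℝ E]

theorem christoffel_spec (p : N) (u v z : TangentSpace 𝓘(ℝ, E) p) :
    2 * g.val p (christoffel g p u v) z = koszul g p u v z :=
  (exists_christoffel g p u v).choose_spec z

theorem christoffel_symm (p : N) (u v : TangentSpace 𝓘(ℝ, E) p) :
    christoffel g p u v = christoffel g p v u := by
  refine SemiRiemannianMetric.ext_left (g := g) fun z => ?_
  have h1 := christoffel_spec g p u v z
  have h2 := christoffel_spec g p v u z
  have h3 : koszul g p u v z = koszul g p v u z := by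
    simp only [koszul, g.symm _ (coordField p u _) (coordField p v _)]
    ring
  linarith

/-- On coordinate fields, the Koszul formula makes the connection metric. -/
theorem mvfderiv_metric_coordField (p : N) (u v z : TangentSpace 𝓘(ℝ, E) p) :
    mvfderiv 𝓘(ℝ, E) (fun q => g.val q (coordField p v q) (coordField p z q)) p u =
      g.val p (christoffel g p u v) z + g.val p v (christoffel g p u z) := by
  have h1 := christoffel_spec g p u v z
  have h2 := christoffel_spec g p u z v
  rw [g.symm p v]
  simp only [koszul] at h1 h2
  simp only [g.symm _ (coordField p z _) (coordField p v _)] at h2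
  linarith

theorem leviCivitaAlong_eq (i : M → N) (W : ∀ x : M, TangentSpace 𝓘(ℝ, E) (i x)) (x : M)
    (v : TangentSpace 𝓘(ℝ, F) x) :
    leviCivitaAlong g i W x v =
      ofCoord (i x) (i x) (mvfderiv 𝓘(ℝ, F) (fun y => coordAt (i x) (i y) (W y)) x v)
        + christoffel g (i x) (mfderiv 𝓘(ℝ, F) 𝓘(ℝ, E) i x v) (W x) := rfl

/-- The Levi-Civita connection is metric. -/
theorem mvfderiv_metric {p : N} {V W : ∀ q : N, TangentSpace 𝓘(ℝ, E) q}
    (hV : MDifferentiableAt 𝓘(ℝ, E) 𝓘(ℝ, E).tangent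
      (fun q => (⟨q, V q⟩ : TangentBundle 𝓘(ℝ, E) N)) p)
    (hW : MDifferentiableAt 𝓘(ℝ, E) 𝓘(ℝ, E).tangent
      (fun q => (⟨q, W q⟩ : TangentBundle 𝓘(ℝ, E) N)) p) (u : TangentSpace 𝓘(ℝ, E) p) :
    mvfderiv 𝓘(ℝ, E) (fun q => g.val q (V q) (W q)) p u =
      g.val p (leviCivitaAlong g (fun q => q) V p u) (W p)
        + g.val p (V p) (leviCivitaAlong g (fun q => q) W p u) := by
  rw [mdifferentiableAt_iff_coordAt] at hV hW
  have hG := mdifferentiableAt_metricCoord g p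
  have hp := mem_chartDomain (E := E) p
  have hGa : ∀ {a : N → E}, MDifferentiableAt 𝓘(ℝ, E) 𝓘(ℝ, E) a p →
      MDifferentiableAt 𝓘(ℝ, E) 𝓘(ℝ, E →L[ℝ] ℝ) (fun q => metricCoord g p q (a q)) p :=
    fun ha => hG.clm_apply ha
  have key : ∀ {a b : N → E}, MDifferentiableAt 𝓘(ℝ, E) 𝓘(ℝ, E) a p →
      MDifferentiableAt 𝓘(ℝ, E) 𝓘(ℝ, E) b p →
      mvfderiv 𝓘(ℝ, E) (fun q => metricCoord g p q (a q) (b q)) p u =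
        mvfderiv 𝓘(ℝ, E) (metricCoord g p) p u (a p) (b p)
          + metricCoord g p p (mvfderiv 𝓘(ℝ, E) a p u) (b p)
          + metricCoord g p p (a p) (mvfderiv 𝓘(ℝ, E) b p u) := by
    intro a b ha hb
    rw [mvfderiv_clm_apply (hGa ha) hb, mvfderiv_clm_apply hG ha]
    rfl
  have h1 : (fun q => g.val q (V q) (W q)) =ᶠ[𝓝 p]
      fun q => metricCoord g p q (coordAt p q (V q)) (coordAt p q (W q)) := by
    filter_upwards [eventually_mem_chartDomain (E := E) p] with q hq
    exact metric_eq_metricCoord g hq _ _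
  have h2 : mvfderiv 𝓘(ℝ, E) (metricCoord g p) p u (coordAt p p (V p)) (coordAt p p (W p)) =
      g.val p (christoffel g p u (V p)) (W p) + g.val p (V p) (christoffel g p u (W p)) := by
    have h3 : (fun q => g.val q (coordField p (V p) q) (coordField p (W p) q)) =ᶠ[𝓝 p]
        fun q => metricCoord g p q (coordAt p p (V p)) (coordAt p p (W p)) := by
      filter_upwards [eventually_mem_chartDomain (E := E) p] with q hq
      rw [metricCoord_apply g hq]
      rfl
    rw [← mvfderiv_metric_coordField, mvfderiv_congr h3,
      key (a := fun _ => coordAt p p (V p)) (b := fun _ => coordAt p p (W p))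
        mdifferentiableAt_const mdifferentiableAt_const]
    simp [mvfderiv_const]
  rw [mvfderiv_congr h1, key hV hW, h2, metricCoord_apply g hp, metricCoord_apply g hp,
    ofCoord_coordAt hp, ofCoord_coordAt hp, leviCivitaAlong_eq, leviCivitaAlong_eq]
  have hid : mfderiv 𝓘(ℝ, E) 𝓘(ℝ, E) (fun q : N => q) p u = u := by
    rw [show (fun q : N => q) = id from rfl, mfderiv_id]
    rfl
  rw [hid]
  simp only [map_add, add_apply]
  ring

/-- The Levi-Civita connection along a map is torsion-free. -/
theorem leviCivitaAlong_sub_leviCivitaAlong [IsManifold 𝓘(ℝ, F) ∞ M] [CompleteSpace F] {i : M → N}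
    {x : M} (hi : ContMDiffAt 𝓘(ℝ, F) 𝓘(ℝ, E) ∞ i x) {X Y : ∀ x : M, TangentSpace 𝓘(ℝ, F) x}
    (hX : MDifferentiableAt 𝓘(ℝ, F) 𝓘(ℝ, F).tangent
      (fun y => (⟨y, X y⟩ : TangentBundle 𝓘(ℝ, F) M)) x)
    (hY : MDifferentiableAt 𝓘(ℝ, F) 𝓘(ℝ, F).tangent
      (fun y => (⟨y, Y y⟩ : TangentBundle 𝓘(ℝ, F) M)) x) :
    leviCivitaAlong g i (fun y => mfderiv 𝓘(ℝ, F) 𝓘(ℝ, E) i y (Y y)) x (X x)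
      - leviCivitaAlong g i (fun y => mfderiv 𝓘(ℝ, F) 𝓘(ℝ, E) i y (X y)) x (Y x) =
      mfderiv 𝓘(ℝ, F) 𝓘(ℝ, E) i x (VectorField.mlieBracket 𝓘(ℝ, F) X Y x) := by
  let f : M → E := fun y => extChartAt 𝓘(ℝ, E) (i x) (i y)
  have hp := mem_chartDomain (E := E) (i x)
  have h2le : (2 : WithTop ℕ∞) ≤ ∞ := WithTop.coe_le_coe.2 le_top
  have hf : ContMDiffAt 𝓘(ℝ, F) 𝓘(ℝ, E) 2 f x :=
    ((contMDiffAt_extChartAt (x := i x)).comp x hi).of_le h2le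
  have hnhds : ∀ᶠ y in 𝓝 x, ContMDiffAt 𝓘(ℝ, F) 𝓘(ℝ, E) 1 i y := by
    obtain ⟨u, hu, hfu⟩ := (contMDiffAt_iff_contMDiffOn_nhds (n := 1) (by simp)).1
      (hi.of_le (by simp))
    filter_upwards [eventually_mem_nhds_iff.2 hu] with y hy
    exact hfu.contMDiffAt hy
  have h1 : ∀ᶠ y in 𝓝 x, ∀ v : TangentSpace 𝓘(ℝ, F) y,
      coordAt (i x) (i y) (mfderiv 𝓘(ℝ, F) 𝓘(ℝ, E) i y v) = mvfderiv 𝓘(ℝ, F) f y v := by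
    filter_upwards [hi.continuousAt.eventually (eventually_mem_chartDomain (E := E) (i x)), hnhds]
      with y hy hy2 v
    rw [coordAt_eq_mvfderiv hy]
    exact (mfderiv_comp_apply y (mdifferentiableAt_extChartAt hy)
      (hy2.mdifferentiableAt (by simp)) v).symm
  have h2 : ∀ Z : ∀ x : M, TangentSpace 𝓘(ℝ, F) x,
      (fun y => coordAt (i x) (i y) (mfderiv 𝓘(ℝ, F) 𝓘(ℝ, E) i y (Z y))) =ᶠ[𝓝 x]
        fun y => mvfderiv 𝓘(ℝ, F) f y (Z y) := fun Z => h1.mono fun y hy => hy (Z y)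
  rw [leviCivitaAlong_eq, leviCivitaAlong_eq, mvfderiv_congr (h2 X), mvfderiv_congr (h2 Y),
    christoffel_symm g _ _ (mfderiv 𝓘(ℝ, F) 𝓘(ℝ, E) i x (Y x)), add_sub_add_right_eq_sub,
    ← map_sub, ← mvfderiv_mlieBracket hf hX hY, ← h1.self_of_nhds, ofCoord_coordAt hp]

end LeviCivita

/-! ### Coordinate vector fields -/

section CoordinateFields

variable {E : Type*} [NormedAddCommGroup E] [NormedSpace ℝ E]
  {N : Type*} [TopologicalSpace N] [ChartedSpace E N] [IsManifold 𝓘(ℝ, E) ∞ N]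

theorem mfderiv_fun_id_apply {N : Type*} [TopologicalSpace N]
    [ChartedSpace E N] (p : N) (u : TangentSpace 𝓘(ℝ, E) p) :
    mfderiv 𝓘(ℝ, E) 𝓘(ℝ, E) (fun q : N => q) p u = u := by
  rw [show (fun q : N => q) = id from rfl, mfderiv_id]
  rfl

theorem contMDiffOn_coordField (p : N) (u : TangentSpace 𝓘(ℝ, E) p) :
    SmoothOn (coordField p u) (chartDomain E p) := by
  refine ((trivializationAt E (TangentSpace 𝓘(ℝ, E) : N → Type _)
    p).contMDiffOn_section_baseSet_iff).2 ?_
  refine (contMDiffOn_const (c := coordAt p p u)).congr fun q hq => ?_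
  rw [trivializationAt_snd hq, coordField_eq, coordAt_ofCoord hq]

theorem contMDiffAt_coordField {p q : N} (hq : q ∈ chartDomain E p) (u : TangentSpace 𝓘(ℝ, E) p) :
    ContMDiffAt 𝓘(ℝ, E) 𝓘(ℝ, E).tangent ∞
      (fun q => (⟨q, coordField p u q⟩ : TangentBundle 𝓘(ℝ, E) N)) q :=
  (contMDiffOn_coordField p u).contMDiffAt ((isOpen_chartDomain p).mem_nhds hq)

theorem exists_smooth_extension_coordField [FiniteDimensional ℝ E] [T2Space N] (p : N)
    (u : TangentSpace 𝓘(ℝ, E) p) :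
    ∃ X : ∀ q : N, TangentSpace 𝓘(ℝ, E) q, SmoothOn X Set.univ ∧ X =ᶠ[𝓝 p] coordField p u := by
  obtain ⟨f⟩ : Nonempty (SmoothBumpFunction 𝓘(ℝ, E) p) := inferInstance
  refine ⟨fun q => f q • coordField p u q, ?_, ?_⟩
  · exact (ContMDiffOn.smul_section_of_tsupport f.contMDiff.contMDiffOn (isOpen_chartDomain p)
      f.tsupport_subset_chartAt_source (contMDiffOn_coordField p u)).contMDiffOn
  · filter_upwards [f.eventuallyEq_one] with q hq
    rw [hq, Pi.one_apply, one_smul]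

/-- The coordinate fields of one chart commute. -/
theorem mlieBracket_coordField [CompleteSpace E] {p q : N} (hq : q ∈ chartDomain E p)
    (u v : TangentSpace 𝓘(ℝ, E) p) :
    VectorField.mlieBracket 𝓘(ℝ, E) (coordField p u) (coordField p v) q = 0 := by
  have hf : ContMDiffAt 𝓘(ℝ, E) 𝓘(ℝ, E) 2 (extChartAt 𝓘(ℝ, E) p) q :=
    (contMDiffAt_extChartAt' hq)
  have h1 : ∀ w : TangentSpace 𝓘(ℝ, E) p,
      (fun y => mvfderiv 𝓘(ℝ, E) (extChartAt 𝓘(ℝ, E) p) y (coordField p w y)) =ᶠ[𝓝 q]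
        fun _ => coordAt p p w := by
    intro w
    filter_upwards [(isOpen_chartDomain (E := E) p).mem_nhds hq] with y hy
    rw [← coordAt_eq_mvfderiv hy, coordField_eq, coordAt_ofCoord hy]
  have h2 := mvfderiv_mlieBracket hf ((contMDiffAt_coordField hq u).mdifferentiableAt (by simp))
    ((contMDiffAt_coordField hq v).mdifferentiableAt (by simp))
  rw [mvfderiv_congr (h1 u), mvfderiv_congr (h1 v), mvfderiv_const, mvfderiv_const,
    ← coordAt_eq_mvfderiv hq] at h2
  rw [← ofCoord_coordAt hq (VectorField.mlieBracket 𝓘(ℝ, E) _ _ q), h2]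
  simp

end CoordinateFields

/-! ### The Levi-Civita connection on vector fields -/

section LeviCivita

variable {E : Type*} [NormedAddCommGroup E] [NormedSpace ℝ E] [FiniteDimensional ℝ E]
  {N : Type*} [TopologicalSpace N] [ChartedSpace E N] [IsManifold 𝓘(ℝ, E) ∞ N]
  (g : SemiRiemannianMetric E N)

/-- The Levi-Civita connection of `g`: the derivative of the vector field `V` at `p` along `u`. -/
def leviCivita (V : ∀ q : N, TangentSpace 𝓘(ℝ, E) q) (p : N) (u : TangentSpace 𝓘(ℝ, E) p) :
    TangentSpace 𝓘(ℝ, E) p :=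
  leviCivitaAlong g (fun q : N => q) V p u

theorem leviCivita_eq (V : ∀ q : N, TangentSpace 𝓘(ℝ, E) q) (p : N)
    (u : TangentSpace 𝓘(ℝ, E) p) :
    leviCivita g V p u = ofCoord p p (mvfderiv 𝓘(ℝ, E) (fun q => coordAt p q (V q)) p u)
      + christoffel g p u (V p) := by
  rw [leviCivita, leviCivitaAlong_eq, mfderiv_fun_id_apply]

theorem leviCivita_coordField (p : N) (u v : TangentSpace 𝓘(ℝ, E) p) :
    leviCivita g (coordField p v) p u = christoffel g p u v := by
  have h : (fun q => coordAt p q (coordField p v q)) =ᶠ[𝓝 p] fun _ => coordAt p p v := by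
    filter_upwards [eventually_mem_chartDomain (E := E) p] with q hq
    rw [coordField_eq, coordAt_ofCoord hq]
  rw [leviCivita_eq, mvfderiv_congr h, mvfderiv_const, coordField_self]
  simp

theorem leviCivita_sub_leviCivita {p : N} {X Y : ∀ q : N, TangentSpace 𝓘(ℝ, E) q}
    (hX : MDifferentiableAt 𝓘(ℝ, E) 𝓘(ℝ, E).tangent
      (fun q => (⟨q, X q⟩ : TangentBundle 𝓘(ℝ, E) N)) p)
    (hY : MDifferentiableAt 𝓘(ℝ, E) 𝓘(ℝ, E).tangent
      (fun q => (⟨q, Y q⟩ : TangentBundle 𝓘(ℝ, E) N)) p) :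
    leviCivita g Y p (X p) - leviCivita g X p (Y p) = VectorField.mlieBracket 𝓘(ℝ, E) X Y p := by
  have h := leviCivitaAlong_sub_leviCivitaAlong g (i := fun q : N => q) contMDiffAt_id hX hY
  simpa only [mfderiv_fun_id_apply] using! h

end LeviCivita

/-! ### The covariant derivative of `φ` -/

section StructureTensor

variable {r : ℕ} {E : Type*} [NormedAddCommGroup E] [NormedSpace ℝ E]
  {N : Type*} [TopologicalSpace N] [ChartedSpace E N] [IsManifold 𝓘(ℝ, E) ∞ N]
  (𝒮 : IndefiniteMetricGFF r E N)

/-- The tensor field `φ` at `q`, as an endomorphism of the coordinate space of the preferred chart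
at `p`. -/
def IndefiniteMetricGFF.φCoord (p q : N) : E →L[ℝ] E :=
  (coordAt p q).comp ((𝒮.φ q).comp (ofCoord p q))

theorem IndefiniteMetricGFF.contMDiffAt_φCoord (p : N) :
    ContMDiffAt 𝓘(ℝ, E) 𝓘(ℝ, E →L[ℝ] E) ∞ (𝒮.φCoord p) p :=
  ((contMDiffAt_hom_bundle _).1 (𝒮.smooth_φ p)).2

theorem IndefiniteMetricGFF.coordAt_φ {p q : N} (hq : q ∈ chartDomain E p)
    (v : TangentSpace 𝓘(ℝ, E) q) : coordAt p q (𝒮.φ q v) = 𝒮.φCoord p q (coordAt p q v) := by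
  simp only [φCoord, ContinuousLinearMap.comp_apply]
  rw [ofCoord_coordAt hq]

theorem IndefiniteMetricGFF.mdifferentiableAt_φ {p : N} {V : ∀ q : N, TangentSpace 𝓘(ℝ, E) q}
    (hV : MDifferentiableAt 𝓘(ℝ, E) 𝓘(ℝ, E).tangent
      (fun q => (⟨q, V q⟩ : TangentBundle 𝓘(ℝ, E) N)) p) :
    MDifferentiableAt 𝓘(ℝ, E) 𝓘(ℝ, E).tangent
      (fun q => (⟨q, 𝒮.φ q (V q)⟩ : TangentBundle 𝓘(ℝ, E) N)) p :=
  ((𝒮.smooth_φ p).mdifferentiableAt (by simp)).clm_bundle_apply hV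

variable [FiniteDimensional ℝ E]

/-- The covariant derivative `(∇_u φ) v` of the tensor field `φ`, in the coordinates of the
preferred chart at `p`. -/
def IndefiniteMetricGFF.nablaφ (p : N) (u v : TangentSpace 𝓘(ℝ, E) p) : TangentSpace 𝓘(ℝ, E) p :=
  ofCoord p p (mvfderiv 𝓘(ℝ, E) (𝒮.φCoord p) p u (coordAt p p v))
    + christoffel 𝒮.g p u (𝒮.φ p v) - 𝒮.φ p (christoffel 𝒮.g p u v)

/-- The Leibniz rule for `φ W`, where `W` is a vector field along `i`. -/
theorem IndefiniteMetricGFF.leviCivitaAlong_φ {F : Type*} [NormedAddCommGroup F] [NormedSpace ℝ F]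
    {M : Type*} [TopologicalSpace M] [ChartedSpace F M] {i : M → N} {x : M}
    (hi : MDifferentiableAt 𝓘(ℝ, F) 𝓘(ℝ, E) i x) {W : ∀ y, TangentSpace 𝓘(ℝ, E) (i y)}
    (hW : MDifferentiableAt 𝓘(ℝ, F) 𝓘(ℝ, E).tangent
      (fun y => (⟨i y, W y⟩ : TangentBundle 𝓘(ℝ, E) N)) x) (v : TangentSpace 𝓘(ℝ, F) x) :
    leviCivitaAlong 𝒮.g i (fun y => 𝒮.φ (i y) (W y)) x v =
      𝒮.φ (i x) (leviCivitaAlong 𝒮.g i W x v)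
        + 𝒮.nablaφ (i x) (mfderiv 𝓘(ℝ, F) 𝓘(ℝ, E) i x v) (W x) := by
  have hp := mem_chartDomain (E := E) (i x)
  have hφ := (𝒮.contMDiffAt_φCoord (i x)).mdifferentiableAt (by simp)
  have hc : MDifferentiableAt 𝓘(ℝ, F) 𝓘(ℝ, E →L[ℝ] E) (fun y => 𝒮.φCoord (i x) (i y)) x :=
    hφ.comp x hi
  have h1 : (fun y => coordAt (i x) (i y) (𝒮.φ (i y) (W y))) =ᶠ[𝓝 x]
      fun y => 𝒮.φCoord (i x) (i y) (coordAt (i x) (i y) (W y)) := by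
    filter_upwards [hi.continuousAt.eventually (eventually_mem_chartDomain (E := E) (i x))]
      with y hy
    exact 𝒮.coordAt_φ hy _
  have h2 : mvfderiv 𝓘(ℝ, F) (fun y => 𝒮.φCoord (i x) (i y)) x v =
      mvfderiv 𝓘(ℝ, E) (𝒮.φCoord (i x)) (i x) (mfderiv 𝓘(ℝ, F) 𝓘(ℝ, E) i x v) :=
    mfderiv_comp_apply x hφ hi v
  have h3 : ∀ a : E, ofCoord (i x) (i x) (𝒮.φCoord (i x) (i x) a) =
      𝒮.φ (i x) (ofCoord (i x) (i x) a) := fun a => ofCoord_coordAt hp _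
  rw [leviCivitaAlong_eq, leviCivitaAlong_eq, mvfderiv_congr h1,
    mvfderiv_clm_apply hc ((mdifferentiableAt_along_iff hi W).1 hW), h2, nablaφ]
  simp only [map_add, h3]
  abel

theorem IndefiniteMetricGFF.leviCivita_φ {p : N} {V : ∀ q : N, TangentSpace 𝓘(ℝ, E) q}
    (hV : MDifferentiableAt 𝓘(ℝ, E) 𝓘(ℝ, E).tangent
      (fun q => (⟨q, V q⟩ : TangentBundle 𝓘(ℝ, E) N)) p) (u : TangentSpace 𝓘(ℝ, E) p) :
    leviCivita 𝒮.g (fun q => 𝒮.φ q (V q)) p u =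
      𝒮.φ p (leviCivita 𝒮.g V p u) + 𝒮.nablaφ p u (V p) := by
  have h := 𝒮.leviCivitaAlong_φ (i := fun q : N => q) mdifferentiableAt_id hV u
  rwa [mfderiv_fun_id_apply] at h

theorem IndefiniteMetricGFF.leviCivita_φ_coordField (p : N) (u v : TangentSpace 𝓘(ℝ, E) p) :
    leviCivita 𝒮.g (fun q => 𝒮.φ q (coordField p v q)) p u =
      𝒮.φ p (christoffel 𝒮.g p u v) + 𝒮.nablaφ p u v := by
  rw [𝒮.leviCivita_φ (mdifferentiableAt_coordField p v), leviCivita_coordField, coordField_self]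

/-- Differentiating the skew-symmetry of `φ` makes `∇_u φ` skew-symmetric. -/
theorem IndefiniteMetricGFF.nablaφ_skew (p : N) (u v w : TangentSpace 𝓘(ℝ, E) p) :
    𝒮.g.val p (𝒮.nablaφ p u v) w = -𝒮.g.val p (𝒮.nablaφ p u w) v := by
  have hv := mdifferentiableAt_coordField p v
  have hw := mdifferentiableAt_coordField p w
  have h1 := mvfderiv_metric 𝒮.g (𝒮.mdifferentiableAt_φ hv) hw u
  have h2 := mvfderiv_metric 𝒮.g hv (𝒮.mdifferentiableAt_φ hw) u
  have h3 : (fun q => 𝒮.g.val q (𝒮.φ q (coordField p v q)) (coordField p w q)) =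
      fun q => -𝒮.g.val q (coordField p v q) (𝒮.φ q (coordField p w q)) := by
    ext q
    exact 𝒮.skew q _ _
  have h4 : mvfderiv 𝓘(ℝ, E)
      (fun q => -𝒮.g.val q (coordField p v q) (𝒮.φ q (coordField p w q))) p u =
      -mvfderiv 𝓘(ℝ, E)
        (fun q => 𝒮.g.val q (coordField p v q) (𝒮.φ q (coordField p w q))) p u := by
    rw [mvfderiv_fun_neg]
    rfl
  rw [h3, h4, h2] at h1
  change -(𝒮.g.val p (leviCivita 𝒮.g (coordField p v) p u) _
    + 𝒮.g.val p _ (leviCivita 𝒮.g (fun q => 𝒮.φ q (coordField p w q)) p u)) =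
    𝒮.g.val p (leviCivita 𝒮.g (fun q => 𝒮.φ q (coordField p v q)) p u) _
    + 𝒮.g.val p _ (leviCivita 𝒮.g (coordField p w) p u) at h1
  rw [𝒮.leviCivita_φ_coordField, 𝒮.leviCivita_φ_coordField, leviCivita_coordField,
    leviCivita_coordField, coordField_self, coordField_self] at h1
  simp only [map_add, add_apply] at h1
  have h5 := 𝒮.skew p (christoffel 𝒮.g p u v) w
  have h6 := 𝒮.skew p v (christoffel 𝒮.g p u w)
  rw [𝒮.g.symm p _ v]
  linarith

end StructureTensor

/-! ### Identities for `∇φ` on an indefinite `𝒮`-manifold -/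

section SStructure

variable {r : ℕ} {E : Type*} [NormedAddCommGroup E] [NormedSpace ℝ E]
  {N : Type*} [TopologicalSpace N] [ChartedSpace E N] [IsManifold 𝓘(ℝ, E) ∞ N]
  {𝒮 : IndefiniteMetricGFF r E N}

theorem IndefiniteMetricGFF.contMDiffAt_η_coordField (𝒮 : IndefiniteMetricGFF r E N) (α : Fin r)
    {p q : N} (hq : q ∈ chartDomain E p) (u : TangentSpace 𝓘(ℝ, E) p) :
    ContMDiffAt 𝓘(ℝ, E) 𝓘(ℝ, ℝ) 2 (fun q => 𝒮.η α q (coordField p u q)) q := by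
  have h : ContMDiffAt 𝓘(ℝ, E) (𝓘(ℝ, E).prod 𝓘(ℝ, ℝ)) ∞
      (fun q => TotalSpace.mk' ℝ (E := Bundle.Trivial N ℝ) q (𝒮.η α q (coordField p u q))) q :=
    ContMDiffAt.clm_bundle_apply (F₁ := E) (F₂ := ℝ) (E₁ := (TangentSpace 𝓘(ℝ, E) : N → Type _))
      (E₂ := Bundle.Trivial N ℝ) (𝒮.smooth_η α q) (contMDiffAt_coordField hq u)
  have h2 := (contMDiffAt_section (F := ℝ) (E := Bundle.Trivial N ℝ) q).1 h
  exact ContMDiffAt.of_le (by simpa using! h2) (WithTop.coe_le_coe.2 le_top)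

variable [FiniteDimensional ℝ E] [T2Space N]

/-- The condition `dη^α = Φ` on coordinate fields. They are only local, so it is applied to global
extensions. -/
theorem IndefiniteMetricGFF.IsSStructure.extDeriv_coordField (h𝒮 : 𝒮.IsSStructure) (α : Fin r)
    {p : N} (u v : TangentSpace 𝓘(ℝ, E) p) : ∀ᶠ q in 𝓝 p,
      mvfderiv 𝓘(ℝ, E) (fun q => 𝒮.η α q (coordField p v q)) q (coordField p u q)
        - mvfderiv 𝓘(ℝ, E) (fun q => 𝒮.η α q (coordField p u q)) q (coordField p v q) =
      2 * 𝒮.g.val q (coordField p u q) (𝒮.φ q (coordField p v q)) := by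
  obtain ⟨X, hX, hXu⟩ := exists_smooth_extension_coordField p u
  obtain ⟨Y, hY, hYv⟩ := exists_smooth_extension_coordField p v
  filter_upwards [hXu.eventuallyEq_nhds, hYv.eventuallyEq_nhds,
    eventually_mem_chartDomain (E := E) p] with q hXq hYq hq
  have h := h𝒮.extDeriv_η α X Y hX hY q
  have h1 : (fun q => 𝒮.η α q (Y q)) =ᶠ[𝓝 q] fun q => 𝒮.η α q (coordField p v q) := by
    filter_upwards [hYq] with q' hq'
    rw [hq']
  have h2 : (fun q => 𝒮.η α q (X q)) =ᶠ[𝓝 q] fun q => 𝒮.η α q (coordField p u q) := by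
    filter_upwards [hXq] with q' hq'
    rw [hq']
  rw [extDeriv, mvfderiv_congr h1, mvfderiv_congr h2, hXq.mlieBracket_vectorField_eq hYq,
    mlieBracket_coordField hq, hXq.self_of_nhds, hYq.self_of_nhds, map_zero] at h
  linarith

/-- The fundamental form `Φ(u, v) = g(u, φ v)` is closed, being the exterior derivative of `η^α`
(at least one `α` is needed). In terms of the Levi-Civita connection this is a cyclic identity for `∇φ`. -/
theorem IndefiniteMetricGFF.IsSStructure.nablaφ_cyclic (h𝒮 : 𝒮.IsSStructure) (hr : 0 < r) (p : N)
    (u v w : TangentSpace 𝓘(ℝ, E) p) :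
    𝒮.g.val p (𝒮.nablaφ p u v) w + 𝒮.g.val p (𝒮.nablaφ p v w) u
      + 𝒮.g.val p (𝒮.nablaφ p w u) v = 0 := by
  let α : Fin r := ⟨0, hr⟩
  -- `2 Φ(b, c) = b(f c) - c(f b)` on coordinate fields, and second derivatives commute.
  let f (a : TangentSpace 𝓘(ℝ, E) p) : N → ℝ := fun q => 𝒮.η α q (coordField p a q)
  have hp := mem_chartDomain (E := E) p
  have hcf := fun a : TangentSpace 𝓘(ℝ, E) p => mdifferentiableAt_coordField p a
  have hf := fun a => 𝒮.contMDiffAt_η_coordField α hp a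
  have hd := fun a b => mdifferentiableAt_mvfderiv_apply (hf a) (hcf b)
  have hcomm : ∀ a b c : TangentSpace 𝓘(ℝ, E) p,
      mvfderiv 𝓘(ℝ, E) (fun q => mvfderiv 𝓘(ℝ, E) (f c) q (coordField p b q)) p a =
      mvfderiv 𝓘(ℝ, E) (fun q => mvfderiv 𝓘(ℝ, E) (f c) q (coordField p a q)) p b := by
    intro a b c
    have h := mvfderiv_mlieBracket (hf c) (hcf a) (hcf b)
    rw [mlieBracket_coordField hp, map_zero, coordField_self, coordField_self] at h
    exact (sub_eq_zero.1 h.symm)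
  have hΦ : ∀ a b c : TangentSpace 𝓘(ℝ, E) p,
      mvfderiv 𝓘(ℝ, E) (fun q => mvfderiv 𝓘(ℝ, E) (f c) q (coordField p b q)) p a
        - mvfderiv 𝓘(ℝ, E) (fun q => mvfderiv 𝓘(ℝ, E) (f b) q (coordField p c q)) p a =
      2 * (𝒮.g.val p (christoffel 𝒮.g p a b) (𝒮.φ p c)
        + 𝒮.g.val p b (𝒮.φ p (christoffel 𝒮.g p a c) + 𝒮.nablaφ p a c)) := by
    intro a b c
    have h1 := mvfderiv_congr (F := E) (h𝒮.extDeriv_coordField α b c)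
    have h2 := congrArg (fun L => L a) h1
    have h3 := mvfderiv_metric 𝒮.g (hcf b) (𝒮.mdifferentiableAt_φ (hcf c)) a
    change mvfderiv 𝓘(ℝ, E) _ p a = 𝒮.g.val p (leviCivita 𝒮.g (coordField p b) p a) _
      + 𝒮.g.val p _ (leviCivita 𝒮.g (fun q => 𝒮.φ q (coordField p c q)) p a) at h3
    rw [leviCivita_coordField, 𝒮.leviCivita_φ_coordField, coordField_self, coordField_self] at h3
    have h4 := mvfderiv_clm ((2 : ℝ) • ContinuousLinearMap.id ℝ ℝ)
      (mdifferentiableAt_metric 𝒮.g (hcf b) (𝒮.mdifferentiableAt_φ (hcf c))) a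
    simp only [smul_apply, ContinuousLinearMap.id_apply, smul_eq_mul] at h4
    rw [← h3, ← h4, ← h2, mvfderiv_fun_sub (hd c b) (hd b c)]
    rfl
  have h1 := hΦ w u v
  have h2 := hΦ u v w
  have h3 := hΦ v w u
  simp only [map_add, 𝒮.g.symm p _ (𝒮.nablaφ p _ _)] at h1 h2 h3
  have e1 := 𝒮.skew p u (christoffel 𝒮.g p w v)
  have e2 := 𝒮.skew p v (christoffel 𝒮.g p u w)
  have e3 := 𝒮.skew p w (christoffel 𝒮.g p v u)
  rw [𝒮.g.symm, christoffel_symm] at e1 e2 e3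
  have s1 := 𝒮.nablaφ_skew p u v w
  have s2 := 𝒮.nablaφ_skew p v w u
  have s3 := 𝒮.nablaφ_skew p w u v
  have c1 := hcomm w u v
  have c2 := hcomm u v w
  have c3 := hcomm v w u
  rw [christoffel_symm 𝒮.g p w v, christoffel_symm 𝒮.g p v u, christoffel_symm 𝒮.g p u w] at *
  linarith

/-- Normality in terms of the Levi-Civita connection: the brackets in the Nijenhuis torsion of
coordinate fields are differences of covariant derivatives, and the Christoffel terms cancel. -/
theorem IndefiniteMetricGFF.IsSStructure.nablaφ_normal (h𝒮 : 𝒮.IsSStructure) (p : N)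
    (u v : TangentSpace 𝓘(ℝ, E) p) :
    𝒮.nablaφ p (𝒮.φ p u) v - 𝒮.nablaφ p (𝒮.φ p v) u + 𝒮.φ p (𝒮.nablaφ p v u)
      - 𝒮.φ p (𝒮.nablaφ p u v) + (2 * 𝒮.g.val p u (𝒮.φ p v)) • ∑ α, 𝒮.ξ α p = 0 := by
  obtain ⟨X, hX, hXu⟩ := exists_smooth_extension_coordField p u
  obtain ⟨Y, hY, hYv⟩ := exists_smooth_extension_coordField p v
  have hp := mem_chartDomain (E := E) p
  have hu := mdifferentiableAt_coordField p u
  have hv := mdifferentiableAt_coordField p v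
  have hXφ : (fun q => 𝒮.φ q (X q)) =ᶠ[𝓝 p] fun q => 𝒮.φ q (coordField p u q) :=
    hXu.mono fun q hq => congrArg (𝒮.φ q) hq
  have hYφ : (fun q => 𝒮.φ q (Y q)) =ᶠ[𝓝 p] fun q => 𝒮.φ q (coordField p v q) :=
    hYv.mono fun q hq => congrArg (𝒮.φ q) hq
  have h := h𝒮.normal X Y hX hY p
  simp only [h𝒮.extDeriv_η _ X Y hX hY p] at h
  rw [nijenhuis, hXφ.mlieBracket_vectorField_eq hYφ, hXu.mlieBracket_vectorField_eq hYv,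
    hXφ.mlieBracket_vectorField_eq hYv, hXu.mlieBracket_vectorField_eq hYφ,
    mlieBracket_coordField hp, hXu.self_of_nhds, hYv.self_of_nhds,
    ← leviCivita_sub_leviCivita 𝒮.g (𝒮.mdifferentiableAt_φ hu) (𝒮.mdifferentiableAt_φ hv),
    ← leviCivita_sub_leviCivita 𝒮.g hu (𝒮.mdifferentiableAt_φ hv),
    ← leviCivita_sub_leviCivita 𝒮.g (𝒮.mdifferentiableAt_φ hu) hv] at h
  simp only [𝒮.leviCivita_φ_coordField, leviCivita_coordField, coordField_self, map_sub, map_add,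
    map_zero, christoffel_symm 𝒮.g p (𝒮.φ p v) u, christoffel_symm 𝒮.g p v, ← Finset.smul_sum,
    smul_smul] at h
  rw [← h]
  abel

/-- `∇φ` in directions `φ u`: the cyclic identity reduces normality to the relation `key` between
the cyclic permutations of `g((∇_{φa} φ) b, c)`, which two instances of it solve. -/
theorem IndefiniteMetricGFF.IsSStructure.nablaφ_φ (h𝒮 : 𝒮.IsSStructure) (hr : 0 < r) (p : N)
    (u v w : TangentSpace 𝓘(ℝ, E) p) :
    𝒮.g.val p (𝒮.nablaφ p (𝒮.φ p u) v) w =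
      -(𝒮.g.val p w (𝒮.φ p u) * 𝒮.g.val p (∑ α, 𝒮.ξ α p) v
        + 𝒮.g.val p u (𝒮.φ p v) * 𝒮.g.val p (∑ α, 𝒮.ξ α p) w) := by
  have key : ∀ a b c : TangentSpace 𝓘(ℝ, E) p,
      𝒮.g.val p (𝒮.nablaφ p (𝒮.φ p a) b) c + 𝒮.g.val p (𝒮.nablaφ p (𝒮.φ p b) c) a
        - 𝒮.g.val p (𝒮.nablaφ p (𝒮.φ p c) a) b =
      -(2 * 𝒮.g.val p a (𝒮.φ p b) * 𝒮.g.val p (∑ α, 𝒮.ξ α p) c) := by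
    intro a b c
    have h1 := congrArg (fun z => 𝒮.g.val p z c) (h𝒮.nablaφ_normal p a b)
    simp only [map_add, map_sub, map_smul, add_apply, sub_apply,
      smul_apply, smul_eq_mul, map_zero, zero_apply, 𝒮.skew p _ c] at h1
    have h2 := h𝒮.nablaφ_cyclic hr p a b (𝒮.φ p c)
    have h3 := 𝒮.nablaφ_skew p (𝒮.φ p b) a c
    have h4 := 𝒮.nablaφ_skew p b a (𝒮.φ p c)
    linarith
  have h1 := key u v w
  have h2 := key w u v
  linarith

end SStructure

/-! ### Vector fields and immersions -/

section Immersion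

variable {E : Type*} [NormedAddCommGroup E] [NormedSpace ℝ E] [FiniteDimensional ℝ E]
  {N : Type*} [TopologicalSpace N] [ChartedSpace E N] [IsManifold 𝓘(ℝ, E) ∞ N]
  {F : Type*} [NormedAddCommGroup F] [NormedSpace ℝ F] [FiniteDimensional ℝ F]
  {M : Type*} [TopologicalSpace M] [ChartedSpace F M] [IsManifold 𝓘(ℝ, F) ∞ M]

/-- A vector field on `M` is smooth if its image under the differential of an immersion is. -/
theorem contMDiffAt_of_mfderiv {i : M → N} {x : M} (hi : ContMDiffAt 𝓘(ℝ, F) 𝓘(ℝ, E) ∞ i x)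
    (hinj : Function.Injective (mfderiv 𝓘(ℝ, F) 𝓘(ℝ, E) i x))
    {Z : ∀ y : M, TangentSpace 𝓘(ℝ, F) y}
    (hZ : ContMDiffAt 𝓘(ℝ, F) 𝓘(ℝ, E).tangent ∞
      (fun y => (⟨i y, mfderiv 𝓘(ℝ, F) 𝓘(ℝ, E) i y (Z y)⟩ : TangentBundle 𝓘(ℝ, E) N)) x) :
    ContMDiffAt 𝓘(ℝ, F) 𝓘(ℝ, F).tangent ∞ (fun y => (⟨y, Z y⟩ : TangentBundle 𝓘(ℝ, F) M)) x := by
  rw [contMDiffAt_along_iff hi] at hZ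
  rw [contMDiffAt_iff_coordAt]
  let A : M → F →L[ℝ] E := fun y =>
    (coordAt (i x) (i y)).comp ((mfderiv 𝓘(ℝ, F) 𝓘(ℝ, E) i y).comp (ofCoord x y))
  have hA : ContMDiffAt 𝓘(ℝ, F) 𝓘(ℝ, F →L[ℝ] E) ∞ A x := hi.mfderiv_const (by simp)
  have hAinj : Function.Injective (A x) := by
    intro a b hab
    have h1 := congrArg (ofCoord (i x) (i x)) hab
    simp only [A, ContinuousLinearMap.comp_apply] at h1
    rw [ofCoord_coordAt (mem_chartDomain _), ofCoord_coordAt (mem_chartDomain _)] at h1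
    have h2 := congrArg (coordAt x x) (hinj h1)
    rwa [coordAt_ofCoord (mem_chartDomain _), coordAt_ofCoord (mem_chartDomain _)] at h2
  obtain ⟨L₀, hL₀⟩ := LinearMap.exists_leftInverse_of_injective (A x).toLinearMap
    (LinearMap.ker_eq_bot.2 hAinj)
  let L : E →L[ℝ] F := L₀.toContinuousLinearMap
  have hLA : ContMDiffAt 𝓘(ℝ, F) 𝓘(ℝ, F →L[ℝ] F) ∞ (fun y => L.comp (A y)) x :=
    contMDiffAt_const.clm_comp hA
  have hLAx : L.comp (A x) = (ContinuousLinearEquiv.refl ℝ F : F →L[ℝ] F) := by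
    ext a
    exact LinearMap.congr_fun hL₀ a
  -- invertibility is an open condition, so the left inverse of `A x` also inverts the nearby `A y`
  have hinv : ∀ᶠ y in 𝓝 x, (L.comp (A y)).IsInvertible := by
    refine hLA.continuousAt.eventually ?_
    change ∀ᶠ y in 𝓝 (L.comp (A x)), y.IsInvertible
    rw [hLAx]
    exact (ContinuousLinearEquiv.refl ℝ F).nhds
  have hsmooth : ContMDiffAt 𝓘(ℝ, F) 𝓘(ℝ, F →L[ℝ] F) ∞ (fun y => (L.comp (A y)).inverse) x := by
    have h := (contDiffAt_map_inverse (n := ∞) (ContinuousLinearEquiv.refl ℝ F)).contMDiffAt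
    rw [← hLAx] at h
    exact ContMDiffAt.comp (g := ContinuousLinearMap.inverse) x h hLA
  refine (hsmooth.clm_apply (contMDiffAt_const.clm_apply (g := fun _ => L) hZ)
    ).congr_of_eventuallyEq ?_
  filter_upwards [hinv, eventually_mem_chartDomain (E := F) x] with y hy hyx
  have h : coordAt (i x) (i y) (mfderiv 𝓘(ℝ, F) 𝓘(ℝ, E) i y (Z y)) = A y (coordAt x y (Z y)) := by
    simp only [A, ContinuousLinearMap.comp_apply]
    rw [ofCoord_coordAt hyx]
  rw [h]
  exact (hy.inverse_apply_self _).symm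

end Immersion

/-! ### Lightlike hypersurfaces -/

section Hypersurface

variable {r : ℕ} {E : Type*} [NormedAddCommGroup E] [NormedSpace ℝ E]
  {N : Type*} [TopologicalSpace N] [ChartedSpace E N] [IsManifold 𝓘(ℝ, E) ∞ N]
  {F : Type*} [NormedAddCommGroup F] [NormedSpace ℝ F]
  {M : Type*} [TopologicalSpace M] [ChartedSpace F M]

theorem IndefiniteMetricGFF.φ_ξ (𝒮 : IndefiniteMetricGFF r E N) (α : Fin r) (p : N) :
    𝒮.φ p (𝒮.ξ α p) = 0 := by
  have h : 𝒮.ξ α p ∈ LinearMap.ker (𝒮.φ p).toLinearMap := by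
    rw [𝒮.ker_φ]
    exact Submodule.subset_span ⟨α, rfl⟩
  exact h

/-- `η^α` is `ε_α g(ξ_α, ·)`. -/
theorem IndefiniteMetricGFF.η_eq_zero (𝒮 : IndefiniteMetricGFF r E N) {α : Fin r} {p : N} {z : TangentSpace 𝓘(ℝ, E) p}
    (hz : 𝒮.g.val p (𝒮.ξ α p) z = 0) : 𝒮.η α p z = 0 := by
  have h := 𝒮.compat p (𝒮.ξ α p) z
  have hε : 𝒮.ε α ≠ 0 := by rcases 𝒮.ε_eq α with h | h <;> simp [h]
  simpa [𝒮.φ_ξ, 𝒮.η_ξ, hz, hε] using h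

theorem metric_ξ_transversal {𝒮 : IndefiniteMetricGFF r E N} {i : M → N}
    {S : ∀ x : M, Submodule ℝ (TangentSpace 𝓘(ℝ, F) x)} {x : M} {e : TangentSpace 𝓘(ℝ, F) x}
    {n : TangentSpace 𝓘(ℝ, E) (i x)} (hSchar : IsCharacteristicScreen 𝒮 i S)
    (hn : IsTransversal 𝒮.g i x (S x) e n) (α : Fin r) :
    𝒮.g.val (i x) (𝒮.ξ α (i x)) n = 0 := by
  obtain ⟨w, hw, h⟩ := hSchar.ker_le x (𝒮.φ_ξ α (i x))
  rw [← h, 𝒮.g.symm]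
  exact hn.orthogonal w hw

theorem metric_ξ_radical {𝒮 : IndefiniteMetricGFF r E N} {i : M → N} {x : M}
    {e : TangentSpace 𝓘(ℝ, F) x} (hMchar : IsCharacteristic F 𝒮 i) (he : e ∈ radical 𝒮.g i x)
    (α : Fin r) : 𝒮.g.val (i x) (𝒮.ξ α (i x)) (diff E F i x e) = 0 := by
  obtain ⟨w, h⟩ := hMchar α x
  rw [← h, 𝒮.g.symm]
  exact he w

variable [FiniteDimensional ℝ E]

/-- `∇φ` vanishes in directions `z` orthogonal to `ξ_1, …, ξ_r`, on the orthogonal complement of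
`z`. -/
theorem IndefiniteMetricGFF.IsSStructure.nablaφ_eq_zero [T2Space N] {𝒮 : IndefiniteMetricGFF r E N}
    (h𝒮 : 𝒮.IsSStructure) (hr : 0 < r) {p : N} {z u v : TangentSpace 𝓘(ℝ, E) p}
    (hz : ∀ α, 𝒮.g.val p (𝒮.ξ α p) z = 0) (hu : 𝒮.g.val p u z = 0) (hv : 𝒮.g.val p v z = 0) :
    𝒮.g.val p (𝒮.nablaφ p z u) v = 0 := by
  have hη : ∀ α, 𝒮.η α p z = 0 := fun α => 𝒮.η_eq_zero (hz α)
  have h1 : 𝒮.φ p (-𝒮.φ p z) = z := by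
    rw [map_neg, 𝒮.φ_sq]
    simp [hη]
  have h2 := h𝒮.nablaφ_φ hr p (-𝒮.φ p z) u v
  have h3 : 𝒮.g.val p (-𝒮.φ p z) (𝒮.φ p u) = 0 := by
    simp only [map_neg, neg_apply]
    rw [𝒮.compat, 𝒮.g.symm, hu]
    simp [hη]
  rw [h1, h3, hv] at h2
  simpa using h2

/-- By the cyclic identity, the difference of both sides is `g((∇_z φ) u, v)` up to sign. -/
theorem IndefiniteMetricGFF.IsSStructure.nablaφ_comm [T2Space N] {𝒮 : IndefiniteMetricGFF r E N}
    (h𝒮 : 𝒮.IsSStructure) (hr : 0 < r) {p : N} {z u v : TangentSpace 𝓘(ℝ, E) p}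
    (hz : ∀ α, 𝒮.g.val p (𝒮.ξ α p) z = 0) (hu : 𝒮.g.val p u z = 0) (hv : 𝒮.g.val p v z = 0) :
    𝒮.g.val p (𝒮.nablaφ p u v) z = 𝒮.g.val p (𝒮.nablaφ p v u) z := by
  have h1 := h𝒮.nablaφ_cyclic hr p u v z
  have h2 := 𝒮.nablaφ_skew p v z u
  have h3 := h𝒮.nablaφ_eq_zero hr hz hu hv
  linarith

variable [FiniteDimensional ℝ F]

section Decomposition

variable {g : SemiRiemannianMetric E N} {i : M → N}
  {S : ∀ x : M, Submodule ℝ (TangentSpace 𝓘(ℝ, F) x)} {x : M}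
  {e : TangentSpace 𝓘(ℝ, F) x} {n : TangentSpace 𝓘(ℝ, E) (i x)}

theorem exists_diff_add_smul (hM : IsLightlikeHypersurface E F g i) (he : e ∈ radical g i x)
    (hn : IsTransversal g i x (S x) e n) (d : TangentSpace 𝓘(ℝ, E) (i x)) :
    ∃ w, ∃ a : ℝ, d = diff E F i x w + a • n := by
  have hd : d ∈ LinearMap.range (diff E F i x) ⊔ Submodule.span ℝ {n} := by
    rw [(isCompl_range_span hM he hn).sup_eq_top]
    trivial
  obtain ⟨_, ⟨w, rfl⟩, y, hy, h⟩ := Submodule.mem_sup.1 hd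
  obtain ⟨a, rfl⟩ := Submodule.mem_span_singleton.1 hy
  exact ⟨w, a, h.symm⟩

theorem eq_smul_of_mem_radical (hM : IsLightlikeHypersurface E F g i) (he : e ∈ radical g i x)
    (hn : IsTransversal g i x (S x) e n) {e' : TangentSpace 𝓘(ℝ, F) x}
    (he' : e' ∈ radical g i x) : e' = g.val (i x) n (diff E F i x e') • e := by
  refine hM.immersion x (SemiRiemannianMetric.ext_left (g := g) fun z => ?_)
  obtain ⟨w, a, rfl⟩ := exists_diff_add_smul hM he hn z
  have h3 := hn.pairing
  rw [g.symm] at h3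
  simp [he w, he' w, h3, g.symm (i x) (diff E F i x e') n]
  ring

theorem mem_screen_iff (hM : IsLightlikeHypersurface E F g i)
    (hS : IsCompl (radical g i x) (S x)) (he : e ∈ radical g i x)
    (hn : IsTransversal g i x (S x) e n) (v : TangentSpace 𝓘(ℝ, F) x) :
    v ∈ S x ↔ g.val (i x) (diff E F i x v) n = 0 := by
  rw [g.symm]
  refine ⟨fun hv => hn.orthogonal v hv, fun hv => ?_⟩
  have hz : v ∈ radical g i x ⊔ S x := by rw [hS.sup_eq_top]; trivial
  obtain ⟨z₁, hz₁, z₂, hz₂, rfl⟩ := Submodule.mem_sup.1 hz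
  have h := eq_smul_of_mem_radical hM he hn hz₁
  rw [map_add, map_add, hn.orthogonal z₂ hz₂, add_zero] at hv
  rw [hv, zero_smul] at h
  rwa [h, zero_add]

theorem isCompl_range_ltr (hM : IsLightlikeHypersurface E F g i)
    (hS : IsCompl (radical g i x) (S x)) (he : e ∈ radical g i x)
    (hn : IsTransversal g i x (S x) e n) :
    IsCompl (LinearMap.range (diff E F i x)) (ltr g i S x) := by
  rw [ltr_eq_span hM hS he hn]
  exact isCompl_range_span hM he hn

theorem tangentPart_diff_add_smul (hM : IsLightlikeHypersurface E F g i)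
    (hS : IsCompl (radical g i x) (S x)) (he : e ∈ radical g i x)
    (hn : IsTransversal g i x (S x) e n) (w : TangentSpace 𝓘(ℝ, F) x) (a : ℝ) :
    tangentPart g i S x (diff E F i x w + a • n) = w := by
  have hc := isCompl_range_ltr hM hS he hn
  have hmem : a • n ∈ ltr g i S x := by
    rw [ltr_eq_span hM hS he hn]
    exact Submodule.smul_mem _ _ (Submodule.mem_span_singleton_self n)
  rw [tangentPart, LinearMap.comp_apply, projAlong, dif_pos hc, map_add,
    Submodule.projection_apply_of_mem_left hc (LinearMap.mem_range_self _ w),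
    Submodule.projection_apply_of_mem_right hc hmem, add_zero,
    LinearMap.leftInverse_apply_of_inj (LinearMap.ker_eq_bot.2 (hM.immersion x))]

/-- The projection in the definition of `B` does not change the pairing with `E`, which is orthogonal
to the hypersurface. -/
theorem localB_eq (hM : IsLightlikeHypersurface E F g i) {e : ∀ x : M, TangentSpace 𝓘(ℝ, F) x}
    (hS : IsCompl (radical g i x) (S x)) (he : e x ∈ radical g i x)
    (hn : IsTransversal g i x (S x) (e x) n) (X Y : ∀ x : M, TangentSpace 𝓘(ℝ, F) x) :
    localB g i S e X Y x = g.val (i x) (ambientConnection g i Y x (X x)) (diff E F i x (e x)) := by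
  have hc := isCompl_range_ltr hM hS he hn
  rw [localB, secondForm]
  obtain ⟨w, a, h⟩ := exists_diff_add_smul hM he hn (ambientConnection g i Y x (X x))
  have hmem : a • n ∈ ltr g i S x := by
    rw [ltr_eq_span hM hS he hn]
    exact Submodule.smul_mem _ _ (Submodule.mem_span_singleton_self n)
  have hw := he w
  rw [g.symm] at hw
  rw [h, projAlong, dif_pos hc.symm, map_add,
    Submodule.projection_apply_of_mem_right hc.symm (LinearMap.mem_range_self _ w),
    Submodule.projection_apply_of_mem_left hc.symm hmem, zero_add, map_add, add_apply, hw, zero_add]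

/-- The projections in the definition of `C` do not change the pairing with `N`, which is null and
orthogonal to the screen. -/
theorem localC_eq (hM : IsLightlikeHypersurface E F g i) {n : ∀ x : M, TangentSpace 𝓘(ℝ, E) (i x)}
    (hS : IsCompl (radical g i x) (S x)) (he : e ∈ radical g i x)
    (hn : IsTransversal g i x (S x) e (n x)) (X Y : ∀ x : M, TangentSpace 𝓘(ℝ, F) x) :
    localC g i S n X Y x = g.val (i x) (ambientConnection g i Y x (X x)) (n x) := by
  rw [localC, screenSecondForm, inducedConnection]
  obtain ⟨w, a, h⟩ := exists_diff_add_smul hM he hn (ambientConnection g i Y x (X x))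
  rw [h, tangentPart_diff_add_smul hM hS he hn]
  have hz : w ∈ radical g i x ⊔ S x := by rw [hS.sup_eq_top]; trivial
  obtain ⟨z₁, hz₁, z₂, hz₂, rfl⟩ := Submodule.mem_sup.1 hz
  have h2 := hn.orthogonal z₂ hz₂
  rw [g.symm] at h2
  rw [projAlong, dif_pos hS, map_add, Submodule.projection_apply_of_mem_left hS hz₁,
    Submodule.projection_apply_of_mem_right hS hz₂]
  simp [h2, hn.null]

end Decomposition

section Characteristic

variable {𝒮 : IndefiniteMetricGFF r E N} {i : M → N}
  {S : ∀ x : M, Submodule ℝ (TangentSpace 𝓘(ℝ, F) x)} {x : M}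
  {e : TangentSpace 𝓘(ℝ, F) x} {n : TangentSpace 𝓘(ℝ, E) (i x)}

/-- As `E` and `N` span the two line bundles, membership in `D₀` amounts to three equations. -/
theorem mem_D₀_iff (hM : IsLightlikeHypersurface E F 𝒮.g i)
    (hS : IsCompl (radical 𝒮.g i x) (S x)) (he : e ∈ radical 𝒮.g i x)
    (hn : IsTransversal 𝒮.g i x (S x) e n) (v : TangentSpace 𝓘(ℝ, F) x) :
    v ∈ D₀ 𝒮 i S x ↔ 𝒮.g.val (i x) (diff E F i x v) n = 0 ∧
      𝒮.g.val (i x) (diff E F i x v) (𝒮.φ (i x) (diff E F i x e)) = 0 ∧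
      𝒮.g.val (i x) (diff E F i x v) (𝒮.φ (i x) n) = 0 := by
  rw [← mem_screen_iff hM hS he hn]
  refine and_congr Iff.rfl (and_congr ⟨fun h => h e he, fun h e' he' => ?_⟩
    ⟨fun h => h n ?_, fun h n' hn' => ?_⟩)
  · rw [eq_smul_of_mem_radical hM he hn he']
    simp [h]
  · rw [ltr_eq_span hM hS he hn]
    exact Submodule.mem_span_singleton_self n
  · rw [ltr_eq_span hM hS he hn] at hn'
    obtain ⟨a, rfl⟩ := Submodule.mem_span_singleton.1 hn'
    simp [h]

/-- `D₀` is invariant under `φ`. -/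
theorem inducedφ_mem_D₀ (hM : IsLightlikeHypersurface E F 𝒮.g i) (hMchar : IsCharacteristic F 𝒮 i)
    (hSchar : IsCharacteristicScreen 𝒮 i S)
    (hS : IsCompl (radical 𝒮.g i x) (S x)) (he : e ∈ radical 𝒮.g i x)
    (hn : IsTransversal 𝒮.g i x (S x) e n) {v : TangentSpace 𝓘(ℝ, F) x}
    (hv : v ∈ D₀ 𝒮 i S x) : inducedφ 𝒮 i S x v ∈ D₀ 𝒮 i S x := by
  have hηe := fun α => 𝒮.η_eq_zero (metric_ξ_radical hMchar he α)
  have hηn := fun α => 𝒮.η_eq_zero (metric_ξ_transversal hSchar hn α)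
  obtain ⟨h1, h2, h3⟩ := (mem_D₀_iff hM hS he hn v).1 hv
  have h4 := he v
  rw [𝒮.g.symm] at h4
  rw [mem_D₀_iff hM hS he hn, diff_inducedφ hM hS he hn hv, 𝒮.skew, h3, 𝒮.compat, 𝒮.compat, h1, h4]
  simp [hηe, hηn]

end Characteristic

end Hypersurface

/-! ### Brackets of sections of `D₀` -/

section Integrability

variable {r : ℕ} {E : Type*} [NormedAddCommGroup E] [NormedSpace ℝ E]
  {N : Type*} [TopologicalSpace N] [ChartedSpace E N] [IsManifold 𝓘(ℝ, E) ∞ N]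
  {F : Type*} [NormedAddCommGroup F] [NormedSpace ℝ F]
  {M : Type*} [TopologicalSpace M] [ChartedSpace F M] [IsManifold 𝓘(ℝ, F) ∞ M]
  {i : M → N}

theorem SmoothOn.mdifferentiableAt {X : ∀ x : M, TangentSpace 𝓘(ℝ, F) x}
    (hX : SmoothOn X Set.univ) (x : M) : MDifferentiableAt 𝓘(ℝ, F) 𝓘(ℝ, F).tangent
      (fun y => (⟨y, X y⟩ : TangentBundle 𝓘(ℝ, F) M)) x :=
  (hX.contMDiffAt Filter.univ_mem).mdifferentiableAt (by simp)

theorem contMDiff_diff (hi : ContMDiff 𝓘(ℝ, F) 𝓘(ℝ, E) ∞ i) {X : ∀ x : M, TangentSpace 𝓘(ℝ, F) x}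
    (hX : SmoothOn X Set.univ) : ContMDiff 𝓘(ℝ, F) 𝓘(ℝ, E).tangent ∞
      (fun y => (⟨i y, diff E F i y (X y)⟩ : TangentBundle 𝓘(ℝ, E) N)) :=
  (hi.contMDiff_tangentMap (m := ∞) (by simp)).comp (contMDiffOn_univ.1 hX)

variable [FiniteDimensional ℝ E] [FiniteDimensional ℝ F]

theorem ambientConnection_sub_ambientConnection (g : SemiRiemannianMetric E N)
    (hi : ContMDiff 𝓘(ℝ, F) 𝓘(ℝ, E) ∞ i) {X Y : ∀ x : M, TangentSpace 𝓘(ℝ, F) x}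
    (hX : SmoothOn X Set.univ) (hY : SmoothOn Y Set.univ) (x : M) :
    ambientConnection g i Y x (X x) - ambientConnection g i X x (Y x) =
      diff E F i x (VectorField.mlieBracket 𝓘(ℝ, F) X Y x) :=
  leviCivitaAlong_sub_leviCivitaAlong g (hi x) (hX.mdifferentiableAt x) (hY.mdifferentiableAt x)

variable {𝒮 : IndefiniteMetricGFF r E N} {S : ∀ x : M, Submodule ℝ (TangentSpace 𝓘(ℝ, F) x)}

theorem isSection_inducedφ (hM : IsLightlikeHypersurface E F 𝒮.g i)
    (hMchar : IsCharacteristic F 𝒮 i) (hSchar : IsCharacteristicScreen 𝒮 i S)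
    (hS : ∀ x, IsCompl (radical 𝒮.g i x) (S x))
    (hen : ∀ x, ∃ e ∈ radical 𝒮.g i x, ∃ n, IsTransversal 𝒮.g i x (S x) e n)
    {Y : ∀ x : M, TangentSpace 𝓘(ℝ, F) x} (hY : IsSection (D₀ 𝒮 i S) Y) :
    IsSection (D₀ 𝒮 i S) (fun y => inducedφ 𝒮 i S y (Y y)) := by
  refine ⟨contMDiffOn_univ.2 fun x => ?_, fun x => ?_⟩
  · refine contMDiffAt_of_mfderiv (hM.smooth x) (hM.immersion x) ?_
    have h1 : (fun y => (⟨i y, mfderiv 𝓘(ℝ, F) 𝓘(ℝ, E) i y (inducedφ 𝒮 i S y (Y y))⟩ :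
        TangentBundle 𝓘(ℝ, E) N)) = fun y => ⟨i y, 𝒮.φ (i y) (diff E F i y (Y y))⟩ := by
      ext1 y
      obtain ⟨e, he, n, hn⟩ := hen y
      exact congrArg (TotalSpace.mk (i y)) (diff_inducedφ hM (hS y) he hn (hY.2 y))
    rw [h1, contMDiffAt_along_iff (hM.smooth x)]
    have h2 := (contMDiffAt_along_iff (hM.smooth x) _).1 (contMDiff_diff hM.smooth hY.1 x)
    have h3 : ContMDiffAt 𝓘(ℝ, F) 𝓘(ℝ, E →L[ℝ] E) ∞ (fun y => 𝒮.φCoord (i x) (i y)) x :=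
      (𝒮.contMDiffAt_φCoord (i x)).comp x (hM.smooth x)
    refine (h3.clm_apply h2).congr_of_eventuallyEq ?_
    filter_upwards [(hM.smooth x).continuousAt.eventually
      (eventually_mem_chartDomain (E := E) (i x))] with y hy
    exact 𝒮.coordAt_φ hy _
  · obtain ⟨e, he, n, hn⟩ := hen x
    exact inducedφ_mem_D₀ hM hMchar hSchar (hS x) he hn (hY.2 x)

/-- For `X, Y ∈ Γ(D₀)` and `z` orthogonal to `ξ_1, …, ξ_r` and to `X`, `Y`, the `∇φ`-terms cancel,
and `g([X, Y], φ z) = g(∇̄_Y φX - ∇̄_X φY, z)`. -/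
theorem metric_mlieBracket_φ [T2Space N] (h𝒮 : 𝒮.IsSStructure) (hr : 0 < r)
    (hM : IsLightlikeHypersurface E F 𝒮.g i)
    (hS : ∀ x, IsCompl (radical 𝒮.g i x) (S x))
    (hen : ∀ x, ∃ e ∈ radical 𝒮.g i x, ∃ n, IsTransversal 𝒮.g i x (S x) e n)
    {X Y : ∀ x : M, TangentSpace 𝓘(ℝ, F) x} (hX : IsSection (D₀ 𝒮 i S) X)
    (hY : IsSection (D₀ 𝒮 i S) Y) {x : M} {z : TangentSpace 𝓘(ℝ, E) (i x)}
    (hz : ∀ α, 𝒮.g.val (i x) (𝒮.ξ α (i x)) z = 0)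
    (hXz : 𝒮.g.val (i x) (diff E F i x (X x)) z = 0)
    (hYz : 𝒮.g.val (i x) (diff E F i x (Y x)) z = 0) :
    𝒮.g.val (i x) (diff E F i x (VectorField.mlieBracket 𝓘(ℝ, F) X Y x)) (𝒮.φ (i x) z) =
      𝒮.g.val (i x) (ambientConnection 𝒮.g i (fun y => inducedφ 𝒮 i S y (X y)) x (Y x)) z
        - 𝒮.g.val (i x) (ambientConnection 𝒮.g i (fun y => inducedφ 𝒮 i S y (Y y)) x (X x)) z := by
  have key : ∀ {V : ∀ x : M, TangentSpace 𝓘(ℝ, F) x}, IsSection (D₀ 𝒮 i S) V →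
      ∀ v : TangentSpace 𝓘(ℝ, F) x,
      ambientConnection 𝒮.g i (fun y => inducedφ 𝒮 i S y (V y)) x v =
        𝒮.φ (i x) (ambientConnection 𝒮.g i V x v)
          + 𝒮.nablaφ (i x) (diff E F i x v) (diff E F i x (V x)) := by
    intro V hV v
    have h1 : (fun y => diff E F i y (inducedφ 𝒮 i S y (V y))) =
        fun y => 𝒮.φ (i y) (diff E F i y (V y)) := by
      ext1 y
      obtain ⟨e, he, n, hn⟩ := hen y
      exact diff_inducedφ hM (hS y) he hn (hV.2 y)
    rw [ambientConnection, h1]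
    exact 𝒮.leviCivitaAlong_φ ((hM.smooth x).mdifferentiableAt (by simp))
      ((contMDiff_diff hM.smooth hV.1 x).mdifferentiableAt (by simp)) v
  have h2 := h𝒮.nablaφ_comm hr hz hXz hYz
  have h3 := 𝒮.skew (i x) (ambientConnection 𝒮.g i Y x (X x)) z
  have h4 := 𝒮.skew (i x) (ambientConnection 𝒮.g i X x (Y x)) z
  rw [key hX, key hY, ← ambientConnection_sub_ambientConnection 𝒮.g hM.smooth hX.1 hY.1]
  simp only [map_add, map_sub, add_apply, sub_apply]
  linarith

end Integrability

end Lightlike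

end

open Lightlike in
theorem mainTheorem2 {r : ℕ} (hr : 0 < r)
    {E : Type*} [NormedAddCommGroup E] [NormedSpace ℝ E] [FiniteDimensional ℝ E]
    {Mbar : Type*} [TopologicalSpace Mbar] [T2Space Mbar] [ChartedSpace E Mbar]
    [IsManifold 𝓘(ℝ, E) ∞ Mbar]
    {F : Type*} [NormedAddCommGroup F] [NormedSpace ℝ F] [FiniteDimensional ℝ F]
    {M : Type*} [TopologicalSpace M] [T2Space M] [ChartedSpace F M] [IsManifold 𝓘(ℝ, F) ∞ M]
    (𝒮 : IndefiniteMetricGFF r E Mbar) (h𝒮 : 𝒮.IsSStructure)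
    (i : M → Mbar) (hM : IsLightlikeHypersurface E F 𝒮.g i) (hMchar : IsCharacteristic F 𝒮 i)
    (S : ∀ x : M, Submodule ℝ (TangentSpace 𝓘(ℝ, F) x))
    (hS : IsScreen 𝒮.g i S) (hSchar : IsCharacteristicScreen 𝒮 i S)
    {ι : Type*} (U : ι → Set M) (hU : ∀ j, IsOpen (U j)) (hcover : ∀ x, ∃ j, x ∈ U j)
    (e : ι → ∀ x : M, TangentSpace 𝓘(ℝ, F) x)
    (he_smooth : ∀ j, SmoothOn (e j) (U j))
    (he : ∀ j, ∀ x ∈ U j, e j x ∈ radical 𝒮.g i x ∧ e j x ≠ 0)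
    (n : ι → ∀ x : M, TangentSpace 𝓘(ℝ, E) (i x))
    (hn : ∀ j, ∀ x ∈ U j, IsTransversal 𝒮.g i x (S x) (e j x) (n j x)) :
    IsIntegrable (D₀ 𝒮 i S) ↔
      ∀ X Y : ∀ x : M, TangentSpace 𝓘(ℝ, F) x,
        IsSection (D₀ 𝒮 i S) X → IsSection (D₀ 𝒮 i S) Y →
        ∀ j, ∀ x ∈ U j,
          localC 𝒮.g i S (n j) X Y x = localC 𝒮.g i S (n j) Y X x ∧
          localC 𝒮.g i S (n j) X (fun y => inducedφ 𝒮 i S y (Y y)) x =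
            localC 𝒮.g i S (n j) (fun y => inducedφ 𝒮 i S y (X y)) Y x ∧
          localB 𝒮.g i S (e j) X (fun y => inducedφ 𝒮 i S y (Y y)) x =
            localB 𝒮.g i S (e j) (fun y => inducedφ 𝒮 i S y (X y)) Y x := by

  have hcompl := hS.isCompl
  have hen : ∀ x, ∃ e ∈ radical 𝒮.g i x, ∃ n, IsTransversal 𝒮.g i x (S x) e n := fun x => by
    obtain ⟨j, hj⟩ := hcover x
    exact ⟨e j x, (he j x hj).1, n j x, hn j x hj⟩
  have hφ : ∀ {Y : ∀ x : M, TangentSpace 𝓘(ℝ, F) x}, IsSection (D₀ 𝒮 i S) Y →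
      IsSection (D₀ 𝒮 i S) (fun y => inducedφ 𝒮 i S y (Y y)) :=
    fun hY => isSection_inducedφ hM hMchar hSchar hcompl hen hY
  -- The three pairings that decide whether `[X, Y]` lies in `D₀`, and the symmetry of `B`. The
  -- arguments `Y`, `φX` of the second and third are interchanged by applying the first and the
  -- last to the pair `φX`, `Y`.
  have key : ∀ X Y : ∀ x : M, TangentSpace 𝓘(ℝ, F) x, IsSection (D₀ 𝒮 i S) X →
      IsSection (D₀ 𝒮 i S) Y → ∀ j, ∀ x ∈ U j,
      𝒮.g.val (i x) (diff E F i x (VectorField.mlieBracket 𝓘(ℝ, F) X Y x)) (n j x) =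
          localC 𝒮.g i S (n j) X Y x - localC 𝒮.g i S (n j) Y X x ∧
        𝒮.g.val (i x) (diff E F i x (VectorField.mlieBracket 𝓘(ℝ, F) X Y x))
            (𝒮.φ (i x) (n j x)) =
          localC 𝒮.g i S (n j) Y (fun y => inducedφ 𝒮 i S y (X y)) x
            - localC 𝒮.g i S (n j) X (fun y => inducedφ 𝒮 i S y (Y y)) x ∧
        𝒮.g.val (i x) (diff E F i x (VectorField.mlieBracket 𝓘(ℝ, F) X Y x))
            (𝒮.φ (i x) (diff E F i x (e j x))) =
          localB 𝒮.g i S (e j) Y (fun y => inducedφ 𝒮 i S y (X y)) x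
            - localB 𝒮.g i S (e j) X (fun y => inducedφ 𝒮 i S y (Y y)) x ∧
        localB 𝒮.g i S (e j) X Y x = localB 𝒮.g i S (e j) Y X x := by
    intro X Y hX hY j x hx
    have hex := (he j x hx).1
    have hnx := hn j x hx
    have hX0 := (mem_D₀_iff hM (hcompl x) hex hnx _).1 (hX.2 x)
    have hY0 := (mem_D₀_iff hM (hcompl x) hex hnx _).1 (hY.2 x)
    have hort : ∀ v : TangentSpace 𝓘(ℝ, F) x,
        𝒮.g.val (i x) (diff E F i x v) (diff E F i x (e j x)) = 0 := fun v => by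
      rw [𝒮.g.symm]
      exact hex v
    simp only [localC_eq hM (hcompl x) hex hnx, localB_eq hM (hcompl x) hex hnx]
    refine ⟨?_, ?_, ?_, ?_⟩
    · rw [← ambientConnection_sub_ambientConnection 𝒮.g hM.smooth hX.1 hY.1, map_sub, sub_apply]
    · exact metric_mlieBracket_φ h𝒮 hr hM hcompl hen hX hY (metric_ξ_transversal hSchar hnx)
        hX0.1 hY0.1
    · exact metric_mlieBracket_φ h𝒮 hr hM hcompl hen hX hY (metric_ξ_radical hMchar hex)
        (hort _) (hort _)
    · rw [← sub_eq_zero, ← sub_apply, ← map_sub,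
        ambientConnection_sub_ambientConnection 𝒮.g hM.smooth hX.1 hY.1, hort]
  constructor
  · intro hint X Y hX hY j x hx
    have hmem := fun v => mem_D₀_iff hM (hcompl x) (he j x hx).1 (hn j x hx) v
    obtain ⟨a1, a2, a3⟩ := (hmem _).1 (hint X Y hX hY x)
    obtain ⟨b1, -, -⟩ := (hmem _).1 (hint _ Y (hφ hX) hY x)
    obtain ⟨k1, k2, k3, -⟩ := key X Y hX hY j x hx
    obtain ⟨l1, -, -, l4⟩ := key _ Y (hφ hX) hY j x hx
    exact ⟨by linarith, by linarith, by linarith⟩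
  · intro h X Y hX hY x
    obtain ⟨j, hx⟩ := hcover x
    obtain ⟨h1, h2, h3⟩ := h X Y hX hY j x hx
    obtain ⟨h4, -, -⟩ := h _ Y (hφ hX) hY j x hx
    obtain ⟨k1, k2, k3, -⟩ := key X Y hX hY j x hx
    obtain ⟨-, -, -, l4⟩ := key _ Y (hφ hX) hY j x hx
    rw [mem_D₀_iff hM (hcompl x) (he j x hx).1 (hn j x hx)]
    exact ⟨by linarith, by linarith, by linarith⟩
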